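/- Let $\mathbb D$ be the open unit disc and $\mathbb T$ the unit circle with normalised Lebesgue measure; let $H^2\subset L^2(\mathbb T)$ be the Hardy space, with norm $\|\cdot\|_2$, and $P:L^2(\mathbb T)\to H^2$ the orthogonal projection. For $\psi\in L^\infty(\mathbb T)$ put $T_\psi f=P(\psi f)$, $f\in H^2$. For $b$ in the closed unit ball of $H^\infty$, $\mathcal H(b)$ is the range of $(I-T_bT_{\bar b})^{1/2}$ on $H^2$, with the range norm $\|f\|_b=\min\{\|g\|_2:(I-T_bT_{\bar b})^{1/2}g=f\}$. We call $(b,a)$ a pair if $a,b\in H^\infty$, $a$ is outer, $a(0)>0$ and $|a|^2+|b|^2=1$ a.e. on $\mathbb T$. For a quotient $\varphi=b/a$ with $(b,a)$ a pair, $T_\varphi$ is the (possibly unbounded) operator of multiplication by $\varphi$ with domain $\{f\in H^2:\varphi f\in H^2\}$, which is dense in $H^2$, and $T_{\overline\varphi}:=T_\varphi^*$ is its adjoint. Let $m\ge 1$ and let $\lambda_1,\dots,\lambda_m\in\mathbb T$ (not necessarily distinct). Let $p,q$ be polynomials of degree at most $m$ with $p(\lambda_j)\neq0$ and $q(\lambda_j)\ne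 0$ for $j=1,\dots,m$. Let $(b,a)$ be the pair with $$\varphi(z)=\frac{p(z)}{\prod_{j=1}^m(1-\overline{\lambda}_jz)}=\frac{b(z)}{a(z)},\qquad\text{and put}\qquad \varphi_m(z)=\frac{z^m}{\prod_{j=1}^m(1-\overline{\lambda}_jz)}.$$ Then $qf$ belongs to the domain of $T_{\overline{\varphi}_m}$ for every $f\in\mathcal H(b)$, and $$\|f\|_b^2=\|f\|_2^2+\|T_{\overline{\varphi}_m}(qf)\|_2^2\qquad\text{for each } f\in\mathcal H(b)$$ if and only if there is a constant $c\in\mathbb C$ with $|c|=1$ such that $q=c\,\widetilde p$, where $\widetilde p(z)=z^m\,\overline{p(1/\bar z)}$. -/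

import Mathlib

open MeasureTheory Polynomial AddCircle
open scoped ENNReal ComplexConjugate InnerProductSpace

noncomputable section

namespace DBR

/-- The unit circle, parametrised by `t ↦ e^{2πit}` with `t ∈ ℝ/ℤ`; it always carries its
normalised Lebesgue (Haar) measure `haarAddCircle`. -/
abbrev T : Type := UnitAddCircle

/-- The point `ζ = e^{2πit}` of the unit circle in `ℂ`. -/
def pt (t : T) : ℂ := (toCircle t : ℂ)

/-- `L²(𝕋)`. -/
abbrev L2 : Type := Lp ℂ 2 (haarAddCircle : Measure T)

/-- `L^∞(𝕋)`. -/
abbrev Linf : Type := Lp ℂ ∞ (haarAddCircle : Measure T)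

/-- The Hardy space `H²`, as the subspace of `L²(𝕋)` of the functions whose Fourier coefficients of
negative index vanish. -/
def H2 : Submodule ℂ L2 where
  carrier := {f | ∀ n : ℤ, n < 0 → fourierCoeff f n = 0}
  zero_mem' n _ := by
    rw [← fourierBasis_repr]
    simp
  add_mem' {f g} hf hg n hn := by
    have h1 := hf n hn
    have h2 := hg n hn
    rw [← fourierBasis_repr] at h1 h2 ⊢
    simp [h1, h2]
  smul_mem' c f hf n hn := by
    have h1 := hf n hn
    rw [← fourierBasis_repr] at h1 ⊢
    simp [h1]

theorem mem_H2 {f : L2} : f ∈ H2 ↔ ∀ n : ℤ, n < 0 → fourierCoeff f n = 0 := Iff.rfl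

theorem isClosed_H2 : IsClosed (H2 : Set L2) := by
  have h : (H2 : Set L2) = ⋂ n : ℤ, ⋂ _ : n < 0,
      {f : L2 | inner ℂ (fourierBasis (T := (1 : ℝ)) n) f = 0} := by
    ext f
    simp only [SetLike.mem_coe, mem_H2, Set.mem_iInter, ← fourierBasis_repr,
      HilbertBasis.repr_apply_apply]
    rfl
  rw [h]
  exact isClosed_iInter fun n => isClosed_iInter fun _ =>
    isClosed_eq (continuous_const.inner continuous_id) continuous_const

instance : CompleteSpace H2 := isClosed_H2.completeSpace_coe

/-- The bounded operator on `L²(𝕋)` of multiplication by `φ ∈ L^∞(𝕋)`. -/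
def mulL (φ : Linf) : L2 →L[ℂ] L2 :=
  (ContinuousLinearMap.mul ℂ ℂ).holderL haarAddCircle ∞ 2 2 φ

theorem coeFn_mulL (φ : Linf) (f : L2) :
    (mulL φ f : T → ℂ) =ᵐ[haarAddCircle] fun t => φ t * f t := by
  simpa [mulL] using (ContinuousLinearMap.mul ℂ ℂ).coeFn_holder (r := 2) φ f

/-- The Toeplitz operator `T_φ f = P(φ f)` on `H²` with bounded symbol `φ ∈ L^∞(𝕋)`, where `P` is
the orthogonal projection of `L²(𝕋)` onto `H²`. -/
def toeplitz (φ : Linf) : H2 →L[ℂ] H2 :=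
  H2.orthogonalProjectionOnto ∘L mulL φ ∘L H2.subtypeL

/-- `H^∞` as the set of the functions in `L^∞(𝕋)` whose Fourier coefficients of negative index
vanish. -/
def Hinf : Set Linf := {b | ∀ n : ℤ, n < 0 → fourierCoeff b n = 0}

/-- The value at the point `z` of the unit disc of the analytic function with boundary function `b`:
`b(z) = ∑_{n ≥ 0} b̂(n) zⁿ`. -/
def discVal (b : Linf) (z : ℂ) : ℂ := ∑' n : ℕ, fourierCoeff b n * z ^ n

/-- Outer functions in `H^∞`: `a(z) = c exp(∫ (ζ + z)/(ζ - z) log |a(ζ)| dm(ζ))` in the disc, with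
`|c| = 1` and `log |a|` integrable on the circle. -/
def IsOuter (a : Linf) : Prop :=
  a ∈ Hinf ∧ Integrable (fun t => Real.log ‖a t‖) (haarAddCircle : Measure T) ∧
    ∃ c : ℂ, ‖c‖ = 1 ∧ ∀ z : ℂ, ‖z‖ < 1 →
      discVal a z =
        c * Complex.exp (∫ t : T, (pt t + z) / (pt t - z) * (Real.log ‖a t‖ : ℂ) ∂haarAddCircle)

/-- `(b, a)` is a pair: `a, b ∈ H^∞`, `a` is outer, `a(0) > 0` and `|a|² + |b|² = 1` a.e. on the
circle. -/
structure IsPair (b a : Linf) : Prop where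
  mem : b ∈ Hinf
  outer : IsOuter a
  re_pos : 0 < (discVal a 0).re
  im_eq_zero : (discVal a 0).im = 0
  sq_add_sq : ∀ᵐ t ∂(haarAddCircle : Measure T), ‖a t‖ ^ 2 + ‖b t‖ ^ 2 = 1

/-- The positive square root of a positive bounded operator on a complex Hilbert space. -/
def opSqrt {H : Type*} [NormedAddCommGroup H] [InnerProductSpace ℂ H] [CompleteSpace H]
    (A : H →L[ℂ] H) : H →L[ℂ] H := CFC.sqrt A

/-- The operator `(I - T_b T_{b̄})^{1/2}` on `H²`, the positive square root. -/
def defect (b : Linf) : H2 →L[ℂ] H2 :=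
  opSqrt (1 - toeplitz b * toeplitz (star b))

/-- The de Branges--Rovnyak space `H(b)` as a subspace of `H²`: the range of
`(I - T_b T_{b̄})^{1/2}`. -/
def dBR (b : Linf) : Submodule ℂ H2 := (defect b).range

/-- The range norm `‖f‖_b`: the least norm of a preimage of `f` under `(I - T_b T_{b̄})^{1/2}`. -/
def normB (b : Linf) (f : H2) : ℝ := sInf {r : ℝ | ∃ g : H2, defect b g = f ∧ r = ‖g‖}

/-- The natural domain `{f ∈ H² : φ f ∈ H²}` of multiplication by a function `φ` on the circle. -/
def mulDomain (φ : T → ℂ) : Submodule ℂ H2 where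
  carrier := {f | ∃ g : H2, (g : L2) =ᵐ[haarAddCircle] fun t => φ t * (f : L2) t}
  zero_mem' := by
    refine ⟨0, ?_⟩
    filter_upwards [Lp.coeFn_zero ℂ 2 (haarAddCircle : Measure T)] with t ht
    simp only [Submodule.coe_zero]
    rw [ht, Pi.zero_apply, mul_zero]
  add_mem' := by
    rintro f₁ f₂ ⟨g₁, h₁⟩ ⟨g₂, h₂⟩
    refine ⟨g₁ + g₂, ?_⟩
    filter_upwards [h₁, h₂, Lp.coeFn_add (f₁ : L2) (f₂ : L2),
      Lp.coeFn_add (g₁ : L2) (g₂ : L2)] with t e₁ e₂ e₃ e₄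
    simp only [Submodule.coe_add] at e₃ e₄ ⊢
    rw [e₄, e₃, Pi.add_apply, Pi.add_apply, e₁, e₂, mul_add]
  smul_mem' := by
    rintro c f ⟨g, h⟩
    refine ⟨c • g, ?_⟩
    filter_upwards [h, Lp.coeFn_smul c (f : L2), Lp.coeFn_smul c (g : L2)] with t e₁ e₂ e₃
    simp only [Submodule.coe_smul] at e₂ e₃ ⊢
    rw [e₃, e₂, Pi.smul_apply, Pi.smul_apply, e₁, smul_eq_mul, smul_eq_mul, mul_left_comm]

/-- The product `φ f ∈ H²` for `f` in the natural domain. -/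
def mulFun (φ : T → ℂ) (f : mulDomain φ) : H2 :=
  Classical.choose (show ∃ g : H2, (g : L2) =ᵐ[haarAddCircle] fun t => φ t * ((f : H2) : L2) t
    from f.2)

theorem coeFn_mulFun (φ : T → ℂ) (f : mulDomain φ) :
    (mulFun φ f : L2) =ᵐ[haarAddCircle] fun t => φ t * ((f : H2) : L2) t :=
  Classical.choose_spec (show ∃ g : H2, (g : L2) =ᵐ[haarAddCircle]
    fun t => φ t * ((f : H2) : L2) t from f.2)

/-- The operator `T_φ` of multiplication by `φ` on `H²`, for a function `φ` on the circle, with its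
natural domain `{f ∈ H² : φ f ∈ H²}`; in general it is unbounded. -/
def toeplitzU (φ : T → ℂ) : H2 →ₗ.[ℂ] H2 where
  domain := mulDomain φ
  toFun :=
    { toFun := mulFun φ
      map_add' := by
        intro f₁ f₂
        apply Subtype.ext
        apply Lp.ext
        filter_upwards [coeFn_mulFun φ f₁, coeFn_mulFun φ f₂, coeFn_mulFun φ (f₁ + f₂),
          Lp.coeFn_add (f₁.1 : L2) (f₂.1 : L2),
          Lp.coeFn_add (mulFun φ f₁ : L2) (mulFun φ f₂ : L2)] with t e₁ e₂ e₃ e₄ e₅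
        simp only [Submodule.coe_add] at e₃ ⊢
        rw [e₃, e₅, Pi.add_apply, e₁, e₂, e₄, Pi.add_apply, mul_add]
      map_smul' := by
        intro c f
        apply Subtype.ext
        apply Lp.ext
        filter_upwards [coeFn_mulFun φ f, coeFn_mulFun φ (c • f), Lp.coeFn_smul c (f.1 : L2),
          Lp.coeFn_smul c (mulFun φ f : L2)] with t e₁ e₂ e₃ e₄
        simp only [Submodule.coe_smul, RingHom.id_apply] at e₂ ⊢
        rw [e₂, e₄, Pi.smul_apply, e₁, e₃, Pi.smul_apply, smul_eq_mul, smul_eq_mul,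
          mul_left_comm] }

theorem coeFn_toeplitzU (φ : T → ℂ) (f : (toeplitzU φ).domain) :
    (toeplitzU φ f : L2) =ᵐ[haarAddCircle] fun t => φ t * ((f : H2) : L2) t :=
  coeFn_mulFun φ f

/-- `T_{φ̄}`, the Hilbert space adjoint of the densely defined operator `T_φ`. -/
def toeplitzConj (φ : T → ℂ) : H2 →ₗ.[ℂ] H2 := (toeplitzU φ).adjoint

/-- The restriction of the polynomial `q` to the circle, as an element of `L^∞(𝕋)`. -/
def polyLinf (q : ℂ[X]) : Linf :=
  ContinuousMap.toLp ∞ haarAddCircle ℂ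
    ⟨fun t : T => q.eval (pt t), q.continuous.comp (by unfold pt; fun_prop)⟩

theorem coeFn_polyLinf (q : ℂ[X]) :
    (polyLinf q : T → ℂ) =ᵐ[haarAddCircle] fun t => q.eval (pt t) :=
  ContinuousMap.coeFn_toLp _ _

theorem coeFn_mulL_poly (q : ℂ[X]) (f : L2) :
    (mulL (polyLinf q) f : T → ℂ) =ᵐ[haarAddCircle] fun t => q.eval (pt t) * f t := by
  filter_upwards [coeFn_mulL (polyLinf q) f, coeFn_polyLinf q] with t h1 h2
  rw [h1, h2]

/-- `H²` is invariant under multiplication by polynomials. -/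
theorem mulL_poly_mem (q : ℂ[X]) {f : L2} (hf : f ∈ H2) : mulL (polyLinf q) f ∈ H2 := by
  induction q using Polynomial.induction_on' with
  | add p q hp hq =>
    have h : mulL (polyLinf (p + q)) f = mulL (polyLinf p) f + mulL (polyLinf q) f := by
      apply Lp.ext
      filter_upwards [coeFn_mulL_poly (p + q) f, coeFn_mulL_poly p f, coeFn_mulL_poly q f,
        Lp.coeFn_add (mulL (polyLinf p) f) (mulL (polyLinf q) f)] with t h1 h2 h3 h4
      rw [h4, Pi.add_apply, h1, h2, h3, eval_add, add_mul]
    rw [h]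
    exact H2.add_mem hp hq
  | monomial k c =>
    intro n hn
    have h : fourierCoeff (mulL (polyLinf (monomial k c)) f : T → ℂ) n
        = c * fourierCoeff (f : T → ℂ) (n - k) := by
      rw [← fourierCoeff.const_mul]
      unfold fourierCoeff
      apply integral_congr_ae
      filter_upwards [coeFn_mulL_poly (monomial k c) f] with t ht
      have e : fourier (-(n - k)) t = fourier (-n) t * (pt t) ^ k := by
        rw [show -(n - (k : ℤ)) = -n + k by ring, fourier_add]
        congr 1
        simp [fourier_apply, pt, toCircle_nsmul]
      rw [ht, eval_monomial, smul_eq_mul, smul_eq_mul, e]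
      ring
    rw [h, hf (n - k) (by omega), mul_zero]

/-- The function `p(ζ) / ∏_j (1 - λ̄_j ζ)` on the circle (defined off the points `λ_j`, hence a.e.). -/
def phi {m : ℕ} (lam : Fin m → Circle) (p : ℂ[X]) (t : T) : ℂ :=
  p.eval (pt t) / ∏ j, (1 - conj (lam j : ℂ) * pt t)

/-- The product `q f ∈ H²` of a polynomial `q` and a function `f ∈ H²`. -/
def polyMul (q : ℂ[X]) (f : H2) : H2 := ⟨mulL (polyLinf q) f, mulL_poly_mem q f.2⟩

end DBR

end

noncomputable section

namespace DBR

open Filter Topology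

/-! Write `D` for the denominator `∏ (1 - λ̄_j z)` and `S` for the shift. Everything reduces to
adjoints of multiplication by polynomials. Since `|a|² + |b|² = 1`, a function `f` lies in `H(b)`
exactly when `T_a* x = T_b* f` has a solution `x`, and then `‖f‖_b² = ‖f‖² + ‖x‖²`
(`mem_range_opSqrt_iff`, `sInf_norm_preimage_opSqrt`). From `b D = a p` and the injectivity of
`T_a*` (`a` is outer, hence cyclic) and of `T_D*`, this equation is equivalent to `T_D* x = T_p* f`.
As `p` and `D` are coprime, its solutions are `f = T_D* k`, `x = T_p* k`, so `‖T_D* k‖_b² = ‖T_D*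
k‖² + ‖T_p* k‖²`.

On the other side, the domain of `T_{φ_m}` is `D H²`, and a computation on the circle gives
`T_{φ̄_m}(q T_D* k) = T_r* k`, where `r` is the reciprocal polynomial of `q`
(`toeplitzConj_polyMul`).

The norm formula therefore says `‖T_p* k‖ = ‖T_r* k‖` for all `k ∈ H²`. Comparing it at `k` and at
`S* k` leaves `|⟨p, k⟩| = |⟨r, k⟩|` for all `k`, which forces `r` to be a unimodular multiple of
`p`. -/

/-! ### Toeplitz operators and the monomial basis of `H²`. -/

theorem pt_norm (t : T) : ‖pt t‖ = 1 := Circle.norm_coe _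

theorem pt_mul_conj (t : T) : pt t * conj (pt t) = 1 := by
  rw [Complex.mul_conj, Complex.normSq_eq_norm_sq, pt_norm]; simp

theorem fourier_eq_pt_pow (n : ℕ) (t : T) : (fourier (n : ℤ) t : ℂ) = pt t ^ n := by
  simp [fourier_apply, pt, toCircle_nsmul]

theorem inner_mulL (φ : Linf) (f g : L2) :
    inner ℂ (mulL φ f) g = inner ℂ f (mulL (star φ) g) := by
  rw [L2.inner_def, L2.inner_def]
  apply integral_congr_ae
  filter_upwards [coeFn_mulL φ f, coeFn_mulL (star φ) g, Lp.coeFn_star φ] with t h1 h2 h3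
  rw [h1, h2, h3]
  simp
  ring

theorem inner_toeplitz (φ : Linf) (f g : H2) :
    inner ℂ (toeplitz φ f) g = inner ℂ (mulL φ f) (g : L2) := by
  simp only [toeplitz, ContinuousLinearMap.comp_apply, Submodule.subtypeL_apply]
  exact Submodule.inner_orthogonalProjectionOnto_eq_of_mem_right g _

theorem adjoint_toeplitz (φ : Linf) :
    ContinuousLinearMap.adjoint (toeplitz φ) = toeplitz (star φ) := by
  symm
  rw [ContinuousLinearMap.eq_adjoint_iff]
  intro f g
  rw [inner_toeplitz, inner_mulL, star_star, ← inner_conj_symm (𝕜 := ℂ) f, inner_toeplitz,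
    inner_conj_symm]

/-- The monomial `zⁿ` in `H²`. -/
def mono (n : ℕ) : H2 := ⟨fourierLp 2 (n : ℤ), fun k hk => by
  rw [← fourierBasis_repr, HilbertBasis.repr_apply_apply, coe_fourierBasis]
  exact orthonormal_fourier.2 (by omega)⟩

theorem coeFn_mono (n : ℕ) : ((mono n : L2) : T → ℂ) =ᵐ[haarAddCircle] fun t => pt t ^ n := by
  filter_upwards [coeFn_fourierLp (T := 1) 2 (n : ℤ)] with t ht
  rw [← fourier_eq_pt_pow, ← ht]
  rfl

theorem inner_mono (n : ℕ) (f : H2) : inner ℂ (mono n) f = fourierCoeff (f : L2) (n : ℤ) := by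
  rw [← fourierBasis_repr, HilbertBasis.repr_apply_apply, coe_fourierBasis]
  rfl

theorem norm_mono (n : ℕ) : ‖mono n‖ = 1 := orthonormal_fourier.1 (n : ℤ)

theorem inner_mono_mono {n k : ℕ} (h : n ≠ k) : inner ℂ (mono n) (mono k) = 0 :=
  orthonormal_fourier.2 (by exact_mod_cast h)

theorem eq_zero_of_inner_mono {f : H2} (h : ∀ n, inner ℂ (mono n) f = 0) : f = 0 := by
  apply Subtype.ext
  apply (fourierBasis (T := (1 : ℝ))).repr.injective
  ext n
  rw [fourierBasis_repr]
  rcases lt_or_ge n 0 with hn | hn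
  · rw [f.2 n hn]; simp
  · lift n to ℕ using hn
    rw [← inner_mono, h n]; simp

theorem summable_inner_mono (f : H2) : Summable fun n => ‖inner ℂ (mono n) f‖ ^ 2 := by
  have h := (hasSum_sq_fourierCoeff (f : L2)).summable
  have h2 := h.comp_injective (Nat.cast_injective (R := ℤ))
  refine h2.congr fun n => ?_
  rw [inner_mono]; rfl

/-! ### Multiplication by polynomials. -/

theorem toeplitz_coe_of_mem {φ : Linf} {f : H2} (h : mulL φ f ∈ H2) :
    (toeplitz φ f : L2) = mulL φ f := by
  simp only [toeplitz, ContinuousLinearMap.comp_apply, Submodule.subtypeL_apply]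
  exact congrArg Subtype.val
    (Submodule.orthogonalProjectionOnto_mem_subspace_eq_self (⟨mulL φ f, h⟩ : H2))

/-- Multiplication by a polynomial on `H²`. -/
def mulP (q : ℂ[X]) : H2 →L[ℂ] H2 := toeplitz (polyLinf q)

theorem mulP_eq_polyMul (q : ℂ[X]) (f : H2) : mulP q f = polyMul q f :=
  Subtype.ext (toeplitz_coe_of_mem (mulL_poly_mem q f.2))

theorem coeFn_mulP (q : ℂ[X]) (f : H2) :
    ((mulP q f : L2) : T → ℂ) =ᵐ[haarAddCircle] fun t => q.eval (pt t) * (f : L2) t := by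
  rw [mulP_eq_polyMul]; exact coeFn_mulL_poly q f

theorem H2_ext {f g : H2} (h : ((f : L2) : T → ℂ) =ᵐ[haarAddCircle] (g : L2)) : f = g :=
  Subtype.ext (Lp.ext h)

theorem mulP_mul (p q : ℂ[X]) : mulP (p * q) = mulP p * mulP q := by
  ext1 f
  apply H2_ext
  rw [mul_apply_eq_comp]
  filter_upwards [coeFn_mulP (p * q) f, coeFn_mulP p (mulP q f), coeFn_mulP q f] with t h1 h2 h3
  rw [h1, h2, h3, eval_mul, mul_assoc]

theorem mulP_comm (p q : ℂ[X]) : mulP p * mulP q = mulP q * mulP p := by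
  rw [← mulP_mul, mul_comm, mulP_mul]

theorem mulP_add (p q : ℂ[X]) : mulP (p + q) = mulP p + mulP q := by
  ext1 f
  apply H2_ext
  rw [add_apply]
  filter_upwards [coeFn_mulP (p + q) f, coeFn_mulP p f, coeFn_mulP q f,
    Lp.coeFn_add (mulP p f : L2) (mulP q f)] with t h1 h2 h3 h4
  rw [Submodule.coe_add, h1, h4, Pi.add_apply, h2, h3, eval_add, add_mul]

theorem mulP_C (c : ℂ) : mulP (C c) = c • 1 := by
  ext1 f
  apply H2_ext
  filter_upwards [coeFn_mulP (C c) f, Lp.coeFn_smul c (f : L2)] with t h1 h2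
  rw [h1]
  simp only [smul_apply, one_apply_eq_self, Submodule.coe_smul, h2]
  simp

theorem mulP_one : mulP 1 = 1 := by
  have := mulP_C 1
  simpa using this

theorem mulP_X_pow_mono (k n : ℕ) : mulP (X ^ k) (mono n) = mono (n + k) := by
  apply H2_ext
  filter_upwards [coeFn_mulP (X ^ k) (mono n), coeFn_mono n, coeFn_mono (n + k)] with t h1 h2 h3
  rw [h1, h2, h3, eval_pow, eval_X, pow_add, mul_comm]

theorem mulP_X_mono (n : ℕ) : mulP X (mono n) = mono (n + 1) := by
  simpa using mulP_X_pow_mono 1 n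

/-- The polynomial functions, as a subspace of `H²`. -/
def polys : Submodule ℂ H2 where
  carrier := {f | ∃ q : ℂ[X], mulP q (mono 0) = f}
  zero_mem' := ⟨0, by simpa using congr($(mulP_C 0) (mono 0))⟩
  add_mem' := by
    rintro _ _ ⟨p, rfl⟩ ⟨q, rfl⟩
    exact ⟨p + q, by rw [mulP_add]; rfl⟩
  smul_mem' := by
    rintro c _ ⟨p, rfl⟩
    exact ⟨C c * p, by rw [mulP_mul, mulP_C]; rfl⟩

theorem dense_of_mono_mem (K : Submodule ℂ H2) (h : ∀ n, mono n ∈ K) : Dense (K : Set H2) := by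
  rw [Submodule.dense_iff_topologicalClosure_eq_top, Submodule.topologicalClosure_eq_top_iff,
    Submodule.eq_bot_iff]
  intro f hf
  exact eq_zero_of_inner_mono fun n => hf _ (h n)

theorem dense_polys : Dense (polys : Set H2) :=
  dense_of_mono_mem _ fun n => ⟨X ^ n, by simpa using mulP_X_pow_mono n 0⟩

theorem inner_smul_left_H2 (f g : H2) (c : ℂ) : inner ℂ (c • f) g = conj c * inner ℂ f g :=
  inner_smul_left f g c

theorem inner_smul_right_H2 (f g : H2) (c : ℂ) : inner ℂ f (c • g) = c * inner ℂ f g :=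
  inner_smul_right f g c

/-! ### Injectivity of the adjoint of multiplication by the denominator. -/

theorem injective_adjoint_of_dense {A : H2 →L[ℂ] H2} (h : DenseRange A) :
    Function.Injective (ContinuousLinearMap.adjoint A) := by
  rw [injective_iff_map_eq_zero]
  intro f hf
  refine h.eq_zero_of_inner_left ℂ fun g => ?_
  rw [← ContinuousLinearMap.adjoint_inner_left, hf, inner_zero_left]

/-- Pairing a kernel element with `(1 - c z) zⁿ` shows that its Fourier coefficients all have the
same modulus; square summability makes them zero. -/
theorem injective_adjoint_one_sub {c : ℂ} (hc : ‖c‖ = 1) :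
    Function.Injective (ContinuousLinearMap.adjoint (mulP (1 - C c * X))) := by
  rw [injective_iff_map_eq_zero]
  intro f hf
  have key : ∀ n, ‖inner ℂ (mono (n + 1)) f‖ = ‖inner ℂ (mono n) f‖ := by
    intro n
    have h1 : mulP (1 - C c * X) (mono n) = mono n - c • mono (n + 1) := by
      rw [sub_eq_add_neg, ← neg_mul, ← C_neg, mulP_add, mulP_mul, mulP_C, mulP_one]
      simp [mulP_X_mono, sub_eq_add_neg]
    have h2 : inner ℂ (mulP (1 - C c * X) (mono n)) f = 0 := by
      rw [← ContinuousLinearMap.adjoint_inner_right, hf, inner_zero_right]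
    rw [h1, inner_sub_left, inner_smul_left_H2, sub_eq_zero] at h2
    rw [h2]; simp [hc]
  have key2 : ∀ n, ‖inner ℂ (mono n) f‖ = ‖inner ℂ (mono 0) f‖ := by
    intro n
    induction n with
    | zero => rfl
    | succ n ih => rw [key, ih]
  have hz := (summable_inner_mono f).tendsto_atTop_zero
  simp only [key2] at hz
  have h0 : ‖inner ℂ (mono 0) f‖ ^ 2 = 0 := tendsto_nhds_unique tendsto_const_nhds hz
  apply eq_zero_of_inner_mono
  intro n
  rw [← norm_eq_zero, key2]
  exact pow_eq_zero_iff (two_ne_zero) |>.mp h0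

/-- The denominator `∏_j (1 - λ̄_j z)`. -/
def den {m : ℕ} (lam : Fin m → Circle) : ℂ[X] := ∏ j, (1 - C (conj (lam j : ℂ)) * X)

theorem injective_adjoint_den {m : ℕ} (lam : Fin m → Circle) :
    Function.Injective (ContinuousLinearMap.adjoint (mulP (den lam))) := by
  unfold den
  refine Finset.prod_induction _
    (fun q => Function.Injective (ContinuousLinearMap.adjoint (mulP q))) ?_ ?_ ?_
  · intro p q hp hq
    rw [mulP_mul, ContinuousLinearMap.mul_def, ContinuousLinearMap.adjoint_comp]
    exact hq.comp hp
  · rw [mulP_one]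
    have h : ContinuousLinearMap.adjoint (1 : H2 →L[ℂ] H2) = 1 := star_one _
    rw [h]
    exact Function.injective_id
  · intro j _
    exact injective_adjoint_one_sub (by rw [RCLike.norm_conj, Circle.norm_coe])

theorem eval_den {m : ℕ} (lam : Fin m → Circle) (z : ℂ) :
    (den lam).eval z = ∏ j, (1 - conj (lam j : ℂ) * z) := by
  simp [den, eval_prod]

/-! ### Range spaces of defect operators on an abstract Hilbert space. -/

section Hilbert

open ContinuousLinearMap

variable {H K L : Type*} [NormedAddCommGroup H] [InnerProductSpace ℂ H] [CompleteSpace H]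
  [NormedAddCommGroup K] [InnerProductSpace ℂ K] [CompleteSpace K]
  [NormedAddCommGroup L] [InnerProductSpace ℂ L] [CompleteSpace L]

theorem norm_adjoint_eq_of_comp_adjoint_eq {R : K →L[ℂ] H} {C : L →L[ℂ] H}
    (h : R ∘L adjoint R = C ∘L adjoint C) (x : H) : ‖adjoint R x‖ = ‖adjoint C x‖ := by
  have h1 : inner ℂ (adjoint R x) (adjoint R x) = inner ℂ (adjoint C x) (adjoint C x) := by
    rw [adjoint_inner_left, adjoint_inner_left]
    exact congr(inner ℂ x ($h x))
  rw [inner_self_eq_norm_sq_to_K, inner_self_eq_norm_sq_to_K] at h1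
  have h2 : ‖adjoint R x‖ ^ 2 = ‖adjoint C x‖ ^ 2 := by exact_mod_cast h1
  exact (pow_left_inj₀ (norm_nonneg _) (norm_nonneg _) two_ne_zero).mp h2

/-- Douglas' lemma: operators with `R R* = C C*` have the same range, with the same range norm. -/
theorem exists_preimage_of_comp_adjoint_eq {R : K →L[ℂ] H} {C : L →L[ℂ] H}
    (h : R ∘L adjoint R = C ∘L adjoint C) (g : K) : ∃ u : L, C u = R g ∧ ‖u‖ ≤ ‖g‖ := by
  have hn := norm_adjoint_eq_of_comp_adjoint_eq h
  let r : H →ₗ[ℂ] K := (adjoint R).toLinearMap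
  let c : H →ₗ[ℂ] L := (adjoint C).toLinearMap
  have hker : c.ker ≤ r.ker := by
    intro x hx
    rw [LinearMap.mem_ker] at hx ⊢
    have : ‖adjoint R x‖ = 0 := by rw [hn]; exact norm_eq_zero.mpr hx
    exact norm_eq_zero.mp this
  let e : c.range →ₗ[ℂ] K := (c.ker.liftQ r hker) ∘ₗ c.quotKerEquivRange.symm.toLinearMap
  have he : ∀ x (hx : c x ∈ c.range), e ⟨c x, hx⟩ = r x := by
    intro x hx
    have : c.quotKerEquivRange.symm ⟨c x, hx⟩ = Submodule.Quotient.mk x :=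
      (LinearEquiv.symm_apply_eq _).mpr rfl
    change c.ker.liftQ r hker (c.quotKerEquivRange.symm ⟨c x, hx⟩) = r x
    rw [this]
    exact Submodule.liftQ_apply _ _ _
  -- The functional `C* x ↦ ⟨g, R* x⟩` is bounded by `‖g‖`; the Riesz vector of a norm-preserving
  -- extension is the required `u`.
  let φ : c.range →L[ℂ] ℂ := ((innerSL ℂ g).toLinearMap ∘ₗ e).mkContinuous ‖g‖ (by
    rintro ⟨_, x, rfl⟩
    change ‖inner ℂ g (e ⟨c x, c.mem_range_self x⟩)‖ ≤ _
    rw [he]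
    refine (norm_inner_le_norm _ _).trans ?_
    exact mul_le_mul_of_nonneg_left (hn x).le (norm_nonneg _))
  obtain ⟨ψ, hψ, hψn⟩ := exists_extension_norm_eq c.range φ
  refine ⟨(InnerProductSpace.toDual ℂ L).symm ψ, ?_, ?_⟩
  · refine ext_inner_right ℂ fun x => ?_
    rw [← adjoint_inner_right, ← adjoint_inner_right, InnerProductSpace.toDual_symm_apply]
    have h1 : ψ (c x) = φ ⟨c x, c.mem_range_self x⟩ := hψ ⟨c x, c.mem_range_self x⟩
    refine h1.trans ?_
    change inner ℂ g (e ⟨c x, c.mem_range_self x⟩) = _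
    rw [he]; rfl
  · rw [LinearIsometryEquiv.norm_map, hψn]
    exact LinearMap.mkContinuous_norm_le _ (norm_nonneg _) _

variable (A B : H →L[ℂ] H)

/-- The pairs `(x, y)` with `A* x = B* y`. -/
def graphSpace : Submodule ℂ (WithLp 2 (H × H)) :=
  (adjoint A ∘L WithLp.fstL 2 ℂ H H - adjoint B ∘L WithLp.sndL 2 ℂ H H).ker

theorem mem_graphSpace {z : WithLp 2 (H × H)} :
    z ∈ graphSpace A B ↔ adjoint A z.fst = adjoint B z.snd := by
  simp [graphSpace, sub_eq_zero]

instance : CompleteSpace (graphSpace A B) :=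
  (ContinuousLinearMap.isClosed_ker _).completeSpace_coe

/-- The second coordinate on `graphSpace A B`. -/
def graphSnd : graphSpace A B →L[ℂ] H := WithLp.sndL 2 ℂ H H ∘L (graphSpace A B).subtypeL

variable {A B}

/-- This realises `1 - B B*` as `V V*` for the coordinate projection `V`, so by Douglas' lemma the
range and range norm of its square root can be read off from the pairs `(x, y)`. It also yields
positivity of `1 - B B*`. -/
theorem graphSnd_comp_adjoint (h : adjoint A ∘L A + adjoint B ∘L B = 1) :
    graphSnd A B ∘L adjoint (graphSnd A B) = 1 - B ∘L adjoint B := by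
  have h' : ∀ x, adjoint A (A x) = x - adjoint B (B x) := fun x =>
    eq_sub_of_add_eq congr($h x)
  ext1 y
  -- This pair is the orthogonal projection of `(0, y)` onto `graphSpace A B`.
  have hmem : WithLp.toLp 2 (A (adjoint B y), y - B (adjoint B y)) ∈ graphSpace A B := by
    rw [mem_graphSpace]
    simp [h']
  have key : adjoint (graphSnd A B) y = ⟨_, hmem⟩ := by
    refine ext_inner_right ℂ fun k => ?_
    have hk := (mem_graphSpace A B).mp k.2
    rw [adjoint_inner_left, Submodule.coe_inner, WithLp.prod_inner_apply]
    rw [← adjoint_inner_right, inner_sub_left, ← adjoint_inner_right B]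
    change inner ℂ y (k : WithLp 2 (H × H)).snd = _
    change _ = inner ℂ (adjoint B y) (adjoint A (k : WithLp 2 (H × H)).fst) +
      (inner ℂ y (k : WithLp 2 (H × H)).snd
        - inner ℂ (adjoint B y) (adjoint B (k : WithLp 2 (H × H)).snd))
    rw [hk]; ring
  rw [ContinuousLinearMap.comp_apply, key]
  rfl

theorem opSqrt_comp_adjoint (h : adjoint A ∘L A + adjoint B ∘L B = 1) :
    opSqrt (1 - B * adjoint B) ∘L adjoint (opSqrt (1 - B * adjoint B)) = 1 - B ∘L adjoint B := by
  have hpos : 0 ≤ 1 - B * adjoint B := by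
    have h2 : (1 - B ∘L adjoint B).IsPositive := by
      rw [← graphSnd_comp_adjoint h]
      exact isPositive_self_comp_adjoint _
    rw [nonneg_iff_isPositive]
    exact h2
  have hs : adjoint (opSqrt (1 - B * adjoint B)) = opSqrt (1 - B * adjoint B) :=
    (IsSelfAdjoint.of_nonneg (CFC.sqrt_nonneg _)).star_eq
  rw [hs]
  exact CFC.sqrt_mul_sqrt_self _ hpos

theorem mem_range_opSqrt_iff (h : adjoint A ∘L A + adjoint B ∘L B = 1) (f : H) :
    f ∈ (opSqrt (1 - B * adjoint B)).range ↔ ∃ x, adjoint A x = adjoint B f := by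
  have hR := (opSqrt_comp_adjoint h).trans (graphSnd_comp_adjoint h).symm
  constructor
  · rintro ⟨g, rfl⟩
    obtain ⟨u, hu, -⟩ := exists_preimage_of_comp_adjoint_eq hR g
    refine ⟨(u : WithLp 2 (H × H)).fst, ?_⟩
    rw [(mem_graphSpace A B).mp u.2]
    exact congrArg _ hu
  · rintro ⟨x, hx⟩
    obtain ⟨g, hg, -⟩ := exists_preimage_of_comp_adjoint_eq hR.symm
      ⟨WithLp.toLp 2 (x, f), (mem_graphSpace A B).mpr hx⟩
    exact ⟨g, hg⟩

theorem sInf_norm_preimage_opSqrt (h : adjoint A ∘L A + adjoint B ∘L B = 1)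
    (hA : Function.Injective (adjoint A)) {f x : H} (hx : adjoint A x = adjoint B f) :
    sInf {r : ℝ | ∃ g : H, opSqrt (1 - B * adjoint B) g = f ∧ r = ‖g‖} ^ 2
      = ‖f‖ ^ 2 + ‖x‖ ^ 2 := by
  have hR := (opSqrt_comp_adjoint h).trans (graphSnd_comp_adjoint h).symm
  let z : graphSpace A B := ⟨WithLp.toLp 2 (x, f), (mem_graphSpace A B).mpr hx⟩
  have hz : ‖z‖ ^ 2 = ‖f‖ ^ 2 + ‖x‖ ^ 2 := by
    rw [Submodule.coe_norm, WithLp.prod_norm_sq_eq_of_L2]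
    simp [z, add_comm]
  obtain ⟨g, hg, hgz⟩ := exists_preimage_of_comp_adjoint_eq hR.symm z
  have hlow : ∀ g', opSqrt (1 - B * adjoint B) g' = f → ‖z‖ ≤ ‖g'‖ := by
    intro g' hg'
    obtain ⟨u, hu, hug⟩ := exists_preimage_of_comp_adjoint_eq hR g'
    have hsnd : (u : WithLp 2 (H × H)).snd = f := hu.trans hg'
    -- Injectivity of `A*` leaves a single pair above `f`, so every preimage of `f` is compared with
    -- the same `z`.
    have hfst : (u : WithLp 2 (H × H)).fst = x :=
      hA (by rw [(mem_graphSpace A B).mp u.2, hsnd, hx])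
    have : u = z := Subtype.ext (by
      apply WithLp.ofLp_injective
      exact Prod.ext hfst hsnd)
    rwa [this] at hug
  have hg1 : opSqrt (1 - B * adjoint B) g = f := hg
  rw [← hz]
  congr 1
  refine IsLeast.csInf_eq ⟨⟨g, hg1, le_antisymm (hlow g hg1) hgz⟩, ?_⟩
  rintro _ ⟨g', hg', rfl⟩
  exact hlow g' hg'

end Hilbert

/-! ### Analytic Toeplitz operators and the identity `T_a* T_a + T_b* T_b = 1`. -/

theorem mulL_mem_H2 {b : Linf} (hb : b ∈ Hinf) (f : H2) : mulL b f ∈ H2 := by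
  have hcl : IsClosed {f : H2 | mulL b f ∈ H2} :=
    isClosed_H2.preimage ((mulL b).continuous.comp continuous_subtype_val)
  have hone : mulL b (mono 0) ∈ H2 := by
    intro n hn
    rw [← hb n hn]
    refine congrFun (fourierCoeff_congr_ae ?_) n
    filter_upwards [coeFn_mulL b (mono 0), coeFn_mono 0] with t h1 h2
    rw [h1, h2]; simp
  refine closure_minimal ?_ hcl (dense_polys f)
  rintro _ ⟨q, rfl⟩
  have : mulL b (mulP q (mono 0)) = mulL (polyLinf q) (mulL b (mono 0)) := by
    apply Lp.ext
    filter_upwards [coeFn_mulL b (mulP q (mono 0)), coeFn_mulP q (mono 0),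
      coeFn_mulL_poly q (mulL b (mono 0)), coeFn_mulL b (mono 0)] with t h1 h2 h3 h4
    rw [h1, h2, h3, h4]; ring
  change mulL b (mulP q (mono 0)) ∈ H2
  rw [this]
  exact mulL_poly_mem q hone

theorem toeplitz_coe {b : Linf} (hb : b ∈ Hinf) (f : H2) : (toeplitz b f : L2) = mulL b f :=
  toeplitz_coe_of_mem (mulL_mem_H2 hb f)

theorem coeFn_toeplitz {b : Linf} (hb : b ∈ Hinf) (f : H2) :
    ((toeplitz b f : L2) : T → ℂ) =ᵐ[haarAddCircle] fun t => b t * (f : L2) t := by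
  rw [toeplitz_coe hb]; exact coeFn_mulL b f

theorem toeplitz_mulP_comm {b : Linf} (hb : b ∈ Hinf) (q : ℂ[X]) :
    toeplitz b * mulP q = mulP q * toeplitz b := by
  ext1 f
  apply H2_ext
  rw [mul_apply_eq_comp, mul_apply_eq_comp]
  filter_upwards [coeFn_toeplitz hb (mulP q f), coeFn_mulP q f, coeFn_mulP q (toeplitz b f),
    coeFn_toeplitz hb f] with t h1 h2 h3 h4
  rw [h1, h2, h3, h4]; ring

theorem IsPair.adjoint_comp_add {b a : Linf} (h : IsPair b a) :
    ContinuousLinearMap.adjoint (toeplitz a) ∘L toeplitz a +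
      ContinuousLinearMap.adjoint (toeplitz b) ∘L toeplitz b = 1 := by
  ext1 f
  refine ext_inner_right ℂ fun g => ?_
  simp only [add_apply, ContinuousLinearMap.comp_apply, inner_add_left,
    ContinuousLinearMap.adjoint_inner_left, one_apply_eq_self]
  simp only [Submodule.coe_inner, L2.inner_def]
  rw [← integral_add (L2.integrable_inner _ _) (L2.integrable_inner _ _)]
  apply integral_congr_ae
  filter_upwards [coeFn_toeplitz h.outer.1 f, coeFn_toeplitz h.outer.1 g, coeFn_toeplitz h.mem f,
    coeFn_toeplitz h.mem g, h.sq_add_sq] with t h1 h2 h3 h4 h5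
  rw [h1, h2, h3, h4]
  simp only [RCLike.inner_apply, map_mul]
  have h6 : conj (a t) * a t + conj (b t) * b t = 1 := by
    rw [mul_comm, Complex.mul_conj, mul_comm, Complex.mul_conj, Complex.normSq_eq_norm_sq,
      Complex.normSq_eq_norm_sq]
    exact_mod_cast h5
  linear_combination ((g : L2) t * conj ((f : L2) t)) * h6

theorem defect_eq (b : Linf) :
    defect b = opSqrt (1 - toeplitz b * ContinuousLinearMap.adjoint (toeplitz b)) := by
  rw [defect, adjoint_toeplitz]

/-! ### Jensen's inequality, for polynomials and then on `H²`. -/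

theorem volume_eq_haarAddCircle : (volume : Measure T) = haarAddCircle := by
  rw [volume_eq_smul_haarAddCircle]; simp

theorem continuous_pt : Continuous pt := by unfold pt; fun_prop

theorem circleMap_two_pi_mul (x : ℝ) : circleMap 0 1 (2 * Real.pi * x) = pt (x : T) := by
  rw [pt, toCircle_apply_mk, Circle.coe_exp, circleMap]
  push_cast
  simp

theorem integrable_log_norm_eval (P : ℂ[X]) :
    Integrable (fun t : T => Real.log ‖P.eval (pt t)‖) haarAddCircle := by
  have hm : AEStronglyMeasurable (fun t : T => Real.log ‖P.eval (pt t)‖) volume :=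
    (Real.measurable_log.comp
      (P.continuous.comp continuous_pt).norm.measurable).aestronglyMeasurable
  rw [← volume_eq_haarAddCircle,
    ← (AddCircle.measurePreserving_mk 1 0).integrable_comp hm]
  have h1 := (P.intervalIntegrable_mahlerMeasure).comp_mul_left (c := 2 * Real.pi)
  rw [zero_div, div_self Real.two_pi_pos.ne',
    intervalIntegrable_iff_integrableOn_Ioc_of_le zero_le_one] at h1
  rw [zero_add]
  refine h1.congr (ae_of_all _ fun x => ?_)
  simp only [Function.comp_apply, circleMap_two_pi_mul]

theorem integral_log_norm_eval (P : ℂ[X]) :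
    ∫ t : T, Real.log ‖P.eval (pt t)‖ ∂haarAddCircle = P.logMahlerMeasure := by
  rw [← volume_eq_haarAddCircle, ← AddCircle.intervalIntegral_preimage 1 0, zero_add,
    logMahlerMeasure_def, Real.circleAverage_def]
  have h := intervalIntegral.integral_comp_mul_left (a := 0) (b := 1)
    (fun θ => Real.log ‖P.eval (circleMap 0 1 θ)‖) Real.two_pi_pos.ne'
  rw [mul_zero, mul_one] at h
  rw [← h]
  simp only [circleMap_two_pi_mul]

/-- The Mahler measure bounds each coefficient up to a binomial factor, which is `1` for the
constant coefficient. -/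
theorem log_norm_coeff_zero_le {P : ℂ[X]} (h : P.coeff 0 ≠ 0) :
    Real.log ‖P.coeff 0‖ ≤ ∫ t : T, Real.log ‖P.eval (pt t)‖ ∂haarAddCircle := by
  rw [integral_log_norm_eval, logMahlerMeasure_eq_log_MahlerMeasure]
  have := norm_coeff_le_choose_mul_mahlerMeasure 0 P
  rw [Nat.choose_zero_right, Nat.cast_one, one_mul] at this
  exact Real.log_le_log (norm_pos_iff.mpr h) this

theorem eval_pt_ne_zero {P : ℂ[X]} (h : P ≠ 0) :
    ∀ᵐ t ∂(haarAddCircle : Measure T), P.eval (pt t) ≠ 0 := by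
  have hf : (pt ⁻¹' (P.roots.toFinset : Set ℂ)).Finite :=
    (Finset.finite_toSet _).preimage fun x _ y _ hxy =>
      injective_toCircle one_ne_zero (Subtype.ext hxy)
  have : NullSingletonClass (volume : Measure T) := ⟨fun x => by
    have := AddCircle.volume_closedBall (T := 1) (x := x) 0
    simpa using this⟩
  rw [← volume_eq_haarAddCircle]
  filter_upwards [hf.countable.ae_notMem (volume : Measure T)] with t ht h0
  exact ht (by simpa [h] using h0)

theorem adjoint_X_mono_zero : ContinuousLinearMap.adjoint (mulP X) (mono 0) = 0 := by
  apply eq_zero_of_inner_mono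
  intro n
  rw [ContinuousLinearMap.adjoint_inner_right, mulP_X_mono]
  exact inner_mono_mono (by omega)

theorem inner_mono_zero_mulP_X (f : H2) : inner ℂ (mono 0) (mulP X f) = 0 := by
  rw [← ContinuousLinearMap.adjoint_inner_left, adjoint_X_mono_zero, inner_zero_left]

theorem inner_mono_zero_mulP (P : ℂ[X]) (f : H2) :
    inner ℂ (mono 0) (mulP P f) = P.coeff 0 * inner ℂ (mono 0) f := by
  conv_lhs => rw [← X_mul_divX_add P, mulP_add, mulP_mul, mulP_C]
  rw [add_apply, inner_add_right, mul_apply_eq_comp, inner_mono_zero_mulP_X, smul_apply,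
    inner_smul_right_H2, one_apply_eq_self, zero_add]

theorem inner_mono_self (n : ℕ) : inner ℂ (mono n) (mono n) = (1 : ℂ) := by
  rw [Submodule.coe_inner, inner_self_eq_norm_sq_to_K, ← Submodule.coe_norm, norm_mono]; simp

theorem integral_norm_le (f : L2) : ∫ t, ‖f t‖ ∂haarAddCircle ≤ ‖f‖ := by
  rw [Lp.norm_def, integral_norm_eq_lintegral_enorm (Lp.aestronglyMeasurable f)]
  refine ENNReal.toReal_mono (Lp.eLpNorm_ne_top f) ?_
  rw [← eLpNorm_one_eq_lintegral_enorm]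
  exact eLpNorm_le_eLpNorm_of_exponent_le one_le_two (Lp.aestronglyMeasurable f)

theorem integrable_L2 (f : L2) : Integrable f haarAddCircle :=
  (Lp.memLp f).integrable one_le_two

section

variable {c : T → ℝ} {δ M : ℝ}

theorem integrable_norm_div (hc : Measurable c) (hδ : 0 < δ) (h1 : ∀ t, δ ≤ c t) (f : L2) :
    Integrable (fun t => ‖f t‖ / c t) haarAddCircle := by
  refine ((integrable_L2 f).norm.const_mul δ⁻¹).mono'
    ((integrable_L2 f).norm.aestronglyMeasurable.div₀ hc.aestronglyMeasurable ) ?_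
  refine ae_of_all _ fun t => ?_
  rw [Real.norm_eq_abs, abs_of_nonneg (div_nonneg (norm_nonneg _) (hδ.le.trans (h1 t))),
    div_eq_inv_mul]
  gcongr
  exact h1 t

/-- Continuity in the `L²` norm is what lets the linearised Jensen inequality pass from polynomials
to all of `H²`. -/
theorem continuous_integral_norm_div (hc : Measurable c) (hδ : 0 < δ) (h1 : ∀ t, δ ≤ c t) :
    Continuous fun f : L2 => ∫ t, ‖f t‖ / c t ∂haarAddCircle := by
  refine (LipschitzWith.of_dist_le_mul (K := (⟨δ⁻¹, (inv_pos.mpr hδ).le⟩ : NNReal)) ?_).continuous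
  intro f g
  rw [Real.dist_eq, ← integral_sub (integrable_norm_div hc hδ h1 f)
    (integrable_norm_div hc hδ h1 g), dist_eq_norm]
  refine (abs_integral_le_integral_abs).trans ?_
  change _ ≤ δ⁻¹ * ‖f - g‖
  refine le_trans ?_ (mul_le_mul_of_nonneg_left (integral_norm_le (f - g)) (inv_pos.mpr hδ).le)
  rw [← integral_const_mul]
  refine integral_mono_ae ((integrable_norm_div hc hδ h1 f).sub
    (integrable_norm_div hc hδ h1 g)).abs ((integrable_L2 _).norm.const_mul _) ?_
  filter_upwards [Lp.coeFn_sub f g] with t ht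
  have hct : 0 < c t := hδ.trans_le (h1 t)
  change |‖f t‖ / c t - ‖g t‖ / c t| ≤ δ⁻¹ * ‖(f - g) t‖
  rw [ht, ← sub_div, abs_div, abs_of_pos hct, div_eq_inv_mul, Pi.sub_apply]
  gcongr
  · exact h1 t
  · exact abs_norm_sub_norm_le _ _

theorem integrable_log (hc : Measurable c) (hδ : 0 < δ) (h1 : ∀ t, δ ≤ c t)
    (h2 : ∀ᵐ t ∂(haarAddCircle : Measure T), c t ≤ M) :
    Integrable (fun t => Real.log (c t)) haarAddCircle := by
  refine Integrable.of_bound (Real.measurable_log.comp hc).aestronglyMeasurable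
    (|Real.log δ| + |Real.log M|) ?_
  filter_upwards [h2] with t ht
  have l1 := Real.log_le_log hδ (h1 t)
  have l2 := Real.log_le_log (hδ.trans_le (h1 t)) ht
  rw [Real.norm_eq_abs, abs_le]
  constructor <;> linarith [neg_abs_le (Real.log δ), le_abs_self (Real.log M),
    abs_nonneg (Real.log δ), abs_nonneg (Real.log M)]

/-- Jensen's inequality on `H²`, with `log |F|` replaced by its tangent `|F| / c + log c - 1`. -/
theorem norm_inner_mono_zero_le (hc : Measurable c) (hδ : 0 < δ) (h1 : ∀ t, δ ≤ c t)
    (h2 : ∀ᵐ t ∂(haarAddCircle : Measure T), c t ≤ M) (F : H2) :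
    ‖inner ℂ (mono 0) F‖ ≤ Real.exp (∫ t, ‖(F : L2) t‖ / c t ∂haarAddCircle
      + ∫ t, (Real.log (c t) - 1) ∂haarAddCircle) := by
  have hcl : IsClosed {F : H2 | ‖inner ℂ (mono 0) F‖ ≤
      Real.exp (∫ t, ‖(F : L2) t‖ / c t ∂haarAddCircle
        + ∫ t, (Real.log (c t) - 1) ∂haarAddCircle)} :=
    isClosed_le (Continuous.norm (innerSL ℂ (mono 0)).continuous)
      (Real.continuous_exp.comp (((continuous_integral_norm_div hc hδ h1).comp
        continuous_subtype_val).add continuous_const))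
  refine closure_minimal ?_ hcl (dense_polys F)
  rintro _ ⟨P, rfl⟩
  have hlog : Integrable (fun t => Real.log (c t) - 1) haarAddCircle :=
    (integrable_log hc hδ h1 h2).sub (integrable_const 1)
  change ‖inner ℂ (mono 0) (mulP P (mono 0))‖ ≤ _
  rw [inner_mono_zero_mulP, inner_mono_self, mul_one]
  by_cases h0 : P.coeff 0 = 0
  · rw [h0, norm_zero]; exact (Real.exp_pos _).le
  rw [← Real.log_le_iff_le_exp (norm_pos_iff.mpr h0)]
  refine (log_norm_coeff_zero_le h0).trans ?_
  rw [← integral_add (integrable_norm_div hc hδ h1 _) hlog]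
  refine integral_mono_ae (integrable_log_norm_eval P)
    ((integrable_norm_div hc hδ h1 _).add hlog) ?_
  have hP : P ≠ 0 := fun h => h0 (by simp [h])
  filter_upwards [coeFn_mulP P (mono 0), coeFn_mono 0, eval_pt_ne_zero hP] with t e1 e2 e3
  have hct : 0 < c t := hδ.trans_le (h1 t)
  rw [e1, e2, pow_zero, mul_one]
  have hpos := norm_pos_iff.mpr e3
  -- The tangent bound `log x ≤ x - 1` at `x = |P| / c`.
  have := Real.log_le_sub_one_of_pos (div_pos hpos hct)
  rw [Real.log_div hpos.ne' hct.ne'] at this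
  linarith

end

/-! ### Outer functions are cyclic. -/

theorem inner_mono_toeplitz_mono {a : Linf} (ha : a ∈ Hinf) :
    inner ℂ (mono 0) (toeplitz a (mono 0)) = discVal a 0 := by
  have h1 : discVal a 0 = fourierCoeff a 0 := by
    rw [discVal, tsum_eq_single 0 (fun n hn => by simp [hn])]
    simp
  rw [h1, inner_mono]
  refine congrFun (fourierCoeff_congr_ae ?_) 0
  filter_upwards [coeFn_toeplitz ha (mono 0), coeFn_mono 0] with t e1 e2
  rw [e1, e2]; simp

theorem IsOuter.norm_discVal_zero {a : Linf} (h : IsOuter a) :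
    ‖discVal a 0‖ = Real.exp (∫ t, Real.log ‖a t‖ ∂haarAddCircle) := by
  obtain ⟨-, -, c, hc, hz⟩ := h
  have h1 : ∫ t : T, (pt t + 0) / (pt t - 0) * (Real.log ‖a t‖ : ℂ) ∂haarAddCircle
      = ((∫ t, Real.log ‖a t‖ ∂haarAddCircle : ℝ) : ℂ) := by
    rw [← integral_complex_ofReal]
    refine integral_congr_ae (ae_of_all _ fun t => ?_)
    have : pt t ≠ 0 := norm_ne_zero_iff.mp (by rw [pt_norm]; exact one_ne_zero)
    simp [this]
  rw [hz 0 (by simp), h1, norm_mul, hc, one_mul, Complex.norm_exp, Complex.ofReal_re]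

/-- The Fourier coefficient of `a w̄` at `-n` is `⟨w, a zⁿ⟩`, so orthogonality of `w` to `a z H²`
makes `a w̄` analytic. -/
theorem exists_conj_mul {a : Linf} (ha : a ∈ Hinf) {w : H2}
    (hw : ∀ n, inner ℂ w (toeplitz a (mono (n + 1))) = 0) :
    ∃ F : H2, ((F : L2) : T → ℂ) =ᵐ[haarAddCircle] (fun t => a t * conj ((w : L2) t)) ∧
      inner ℂ (mono 0) F = inner ℂ w (toeplitz a (mono 0)) := by
  have hae : (mulL a (star (w : L2)) : T → ℂ) =ᵐ[haarAddCircle]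
      fun t => a t * conj ((w : L2) t) := by
    filter_upwards [coeFn_mulL a (star (w : L2)), Lp.coeFn_star (w : L2)] with t e1 e2
    rw [e1, e2]; rfl
  have key : ∀ n : ℕ, fourierCoeff (mulL a (star (w : L2))) (-(n : ℤ))
      = inner ℂ w (toeplitz a (mono n)) := by
    intro n
    rw [Submodule.coe_inner, L2.inner_def, fourierCoeff]
    apply integral_congr_ae
    filter_upwards [hae, coeFn_toeplitz ha (mono n), coeFn_mono n] with t e1 e2 e3
    rw [e1, e2, e3, neg_neg, fourier_eq_pt_pow, smul_eq_mul, RCLike.inner_apply]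
    ring
  have hmem : mulL a (star (w : L2)) ∈ H2 := by
    intro n hn
    obtain ⟨k, rfl⟩ : ∃ k : ℕ, n = -((k + 1 : ℕ) : ℤ) := ⟨(-n - 1).toNat, by omega⟩
    rw [key, hw]
  refine ⟨⟨_, hmem⟩, hae, ?_⟩
  have := key 0
  rw [← this, inner_mono]
  simp

theorem tendsto_integral_log_add {a : Linf}
    (h1 : ∀ᵐ t ∂(haarAddCircle : Measure T), ‖a t‖ ≤ 1)
    (h0 : ∀ᵐ t ∂(haarAddCircle : Measure T), a t ≠ 0)
    (hint : Integrable (fun t => Real.log ‖a t‖) (haarAddCircle : Measure T)) :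
    Tendsto (fun n : ℕ => ∫ t, Real.log (‖a t‖ + 1 / ((n : ℝ) + 1)) ∂haarAddCircle) atTop
      (𝓝 (∫ t, Real.log ‖a t‖ ∂haarAddCircle)) := by
  have hm : Measurable fun t => ‖a t‖ := (Lp.stronglyMeasurable a).norm.measurable
  refine tendsto_integral_of_dominated_convergence (fun t => |Real.log ‖a t‖| + Real.log 2)
    (fun n => (Real.measurable_log.comp (hm.add_const _)).aestronglyMeasurable)
    (hint.abs.add (integrable_const _)) ?_ ?_
  · intro n
    filter_upwards [h1, h0] with t e1 e0
    have hpos : 0 < ‖a t‖ := norm_pos_iff.mpr e0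
    have hn : 0 < 1 / ((n : ℝ) + 1) := by positivity
    have hn1 : 1 / ((n : ℝ) + 1) ≤ 1 := by
      rw [div_le_one (by positivity)]; linarith [(Nat.cast_nonneg n : (0 : ℝ) ≤ n)]
    have l1 := Real.log_le_log hpos (by linarith : ‖a t‖ ≤ ‖a t‖ + 1 / ((n : ℝ) + 1))
    have l2 := Real.log_le_log (by linarith) (by linarith : ‖a t‖ + 1 / ((n : ℝ) + 1) ≤ 2)
    have l3 : 0 ≤ Real.log 2 := Real.log_nonneg one_le_two
    rw [Real.norm_eq_abs, abs_le]
    constructor <;> linarith [neg_abs_le (Real.log ‖a t‖), abs_nonneg (Real.log ‖a t‖)]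
  · filter_upwards [h0] with t e0
    have hpos : ‖a t‖ ≠ 0 := norm_ne_zero_iff.mpr e0
    have := (tendsto_const_nhds (x := ‖a t‖)).add (tendsto_one_div_add_atTop_nhds_zero_nat (𝕜 := ℝ))
    rw [add_zero] at this
    exact (Real.continuousAt_log hpos).tendsto.comp this

/-- For `F = a w̄` one has `F(0) = ‖w‖²`, and Jensen's inequality gives `log ‖w‖² ≤ ∫ log |a| + ∫
log |w| ≤ ∫ log |a| + log ‖w‖`. The tangent form is used with weight `c = ‖w‖ (|a| + δ)`, where `δ >
0` keeps `c` away from zero and tends to `0` at the end. -/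
theorem norm_le_exp_integral_log {a : Linf} (ha : a ∈ Hinf)
    (h1 : ∀ᵐ t ∂(haarAddCircle : Measure T), ‖a t‖ ≤ 1)
    (h0 : ∀ᵐ t ∂(haarAddCircle : Measure T), a t ≠ 0)
    (hint : Integrable (fun t => Real.log ‖a t‖) (haarAddCircle : Measure T)) {w : H2}
    (hw : ∀ n, inner ℂ w (toeplitz a (mono (n + 1))) = 0)
    (hww : inner ℂ w (toeplitz a (mono 0)) = inner ℂ w w) :
    ‖w‖ ≤ Real.exp (∫ t, Real.log ‖a t‖ ∂haarAddCircle) := by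
  rcases eq_or_ne w 0 with rfl | hw0
  · rw [norm_zero]; exact (Real.exp_pos _).le
  have hk : 0 < ‖w‖ := norm_pos_iff.mpr hw0
  obtain ⟨F, hF, hF0⟩ := exists_conj_mul ha hw
  have hm : Measurable fun t => ‖a t‖ := (Lp.stronglyMeasurable a).norm.measurable
  refine ge_of_tendsto (Real.continuous_exp.tendsto _ |>.comp (tendsto_integral_log_add h1 h0 hint))
    (Eventually.of_forall fun n => ?_)
  change ‖w‖ ≤ Real.exp (∫ t, Real.log (‖a t‖ + 1 / ((n : ℝ) + 1)) ∂haarAddCircle)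
  have hn : 0 < 1 / ((n : ℝ) + 1) := by positivity
  generalize 1 / ((n : ℝ) + 1) = δ at hn
  have hδ : 0 < ‖w‖ * δ := mul_pos hk hn
  have hlow : ∀ t, ‖w‖ * δ ≤ ‖w‖ * (‖a t‖ + δ) := fun t =>
    mul_le_mul_of_nonneg_left (by linarith [norm_nonneg (a t)]) hk.le
  have hlow' : ∀ t, δ ≤ ‖a t‖ + δ := fun t => by linarith [norm_nonneg (a t)]
  have hc : Measurable fun t => ‖w‖ * (‖a t‖ + δ) := (hm.add_const δ).const_mul _
  have hup : ∀ᵐ t ∂(haarAddCircle : Measure T), ‖w‖ * (‖a t‖ + δ) ≤ ‖w‖ * (1 + δ) := by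
    filter_upwards [h1] with t ht
    gcongr
  have hup' : ∀ᵐ t ∂(haarAddCircle : Measure T), ‖a t‖ + δ ≤ 1 + δ := by
    filter_upwards [h1] with t ht
    gcongr
  have hJ := norm_inner_mono_zero_le hc hδ hlow hup F
  rw [hF0, hww, Submodule.coe_inner, inner_self_eq_norm_sq_to_K, ← Submodule.coe_norm] at hJ
  have hlog := integrable_log (hm.add_const δ) hn hlow' hup'
  -- The integrand is at most `|w| / ‖w‖`; the bound `1` cancels the `-1` of the tangent.
  have i1 : ∫ t, ‖(F : L2) t‖ / (‖w‖ * (‖a t‖ + δ)) ∂haarAddCircle ≤ 1 := by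
    have : ∫ t, ‖(F : L2) t‖ / (‖w‖ * (‖a t‖ + δ)) ∂haarAddCircle
        ≤ ∫ t, ‖w‖⁻¹ * ‖(w : L2) t‖ ∂haarAddCircle := by
      refine integral_mono_ae (integrable_norm_div hc hδ hlow _)
        ((integrable_L2 _).norm.const_mul _) ?_
      filter_upwards [hF] with t ht
      have hp : 0 < ‖a t‖ + δ := hn.trans_le (hlow' t)
      change ‖(F : L2) t‖ / (‖w‖ * (‖a t‖ + δ)) ≤ ‖w‖⁻¹ * ‖(w : L2) t‖
      rw [ht, norm_mul, RCLike.norm_conj, div_le_iff₀ (mul_pos hk hp)]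
      have : ‖w‖⁻¹ * ‖(w : L2) t‖ * (‖w‖ * (‖a t‖ + δ)) = ‖(w : L2) t‖ * (‖a t‖ + δ) := by
        field_simp
      rw [this]
      nlinarith [norm_nonneg ((w : L2) t)]
    refine this.trans ?_
    rw [integral_const_mul, inv_mul_le_iff₀ hk, mul_one]
    exact integral_norm_le _
  have i2 : ∫ t, (Real.log (‖w‖ * (‖a t‖ + δ)) - 1) ∂haarAddCircle
      = Real.log ‖w‖ - 1 + ∫ t, Real.log (‖a t‖ + δ) ∂haarAddCircle := by
    have : ∀ t, Real.log (‖w‖ * (‖a t‖ + δ)) - 1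
        = (Real.log ‖w‖ - 1) + Real.log (‖a t‖ + δ) := fun t => by
      rw [Real.log_mul hk.ne' (hn.trans_le (hlow' t)).ne']; ring
    simp only [this]
    rw [integral_add (integrable_const _) hlog, integral_const]
    simp
  rw [i2] at hJ
  have hJ2 : ‖w‖ * ‖w‖ ≤ ‖w‖ * Real.exp (∫ t, Real.log (‖a t‖ + δ) ∂haarAddCircle) := by
    have e : ‖((‖w‖ : ℂ)) ^ 2‖ = ‖w‖ * ‖w‖ := by
      rw [norm_pow, Complex.norm_real, norm_norm, sq]
    refine (e.symm.le.trans hJ).trans ?_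
    calc _ ≤ Real.exp (Real.log ‖w‖ + ∫ t, Real.log (‖a t‖ + δ) ∂haarAddCircle) :=
          Real.exp_le_exp.mpr (by linarith)
      _ = _ := by rw [Real.exp_add, Real.exp_log hk]
  exact le_of_mul_le_mul_left hJ2 hk

theorem denseRange_toeplitz_of_mono_mem {a : Linf} (ha : a ∈ Hinf)
    (h : mono 0 ∈ closure (Set.range (toeplitz a))) : DenseRange (toeplitz a) := by
  have hd := dense_of_mono_mem (toeplitz a).range.topologicalClosure fun n => by
    have := map_mem_closure (mulP (X ^ n)).continuous h (t := Set.range (toeplitz a)) (by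
      rintro _ ⟨f, rfl⟩
      exact ⟨mulP (X ^ n) f, congr($(toeplitz_mulP_comm ha (X ^ n)) f)⟩)
    rw [mulP_X_pow_mono, zero_add] at this
    exact this
  have h2 : Dense (closure (Set.range (toeplitz a))) := hd
  exact dense_closure.mp h2

/-- An outer function is cyclic in `H²`. -/
theorem IsOuter.denseRange {a : Linf} (h : IsOuter a)
    (h1 : ∀ᵐ t ∂(haarAddCircle : Measure T), ‖a t‖ ≤ 1)
    (h0 : ∀ᵐ t ∂(haarAddCircle : Measure T), a t ≠ 0) : DenseRange (toeplitz a) := by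
  have ha := h.1
  let N : Submodule ℂ H2 := (toeplitz a ∘L mulP X).range.topologicalClosure
  have hN : CompleteSpace N := (Submodule.isClosed_topologicalClosure _).completeSpace_coe
  -- `w` is the component of `a` orthogonal to the closure of `a z H²`.
  obtain ⟨y, hy, w, hw, hyw⟩ := N.exists_add_mem_mem_orthogonal (toeplitz a (mono 0))
  have hy' : y ∈ closure (Set.range (toeplitz a ∘L mulP X)) := hy
  have hw1 : ∀ n, inner ℂ w (toeplitz a (mono (n + 1))) = 0 := fun n => by
    refine (Submodule.mem_orthogonal' N w).mp hw _ ?_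
    rw [← mulP_X_mono]
    exact Submodule.le_topologicalClosure _ ⟨mono n, rfl⟩
  have hw2 : inner ℂ w (toeplitz a (mono 0)) = inner ℂ w w := by
    rw [hyw, inner_add_right, (Submodule.mem_orthogonal' N w).mp hw y hy, zero_add]
  have hy0 : inner ℂ (mono 0) y = 0 := by
    have hcl : IsClosed {y : H2 | inner ℂ (mono 0) y = 0} :=
      isClosed_eq (innerSL ℂ (mono 0)).continuous continuous_const
    refine closure_minimal ?_ hcl (hy')
    rintro _ ⟨f, rfl⟩
    change inner ℂ (mono 0) ((toeplitz a * mulP X) f) = 0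
    rw [toeplitz_mulP_comm ha, mul_apply_eq_comp, inner_mono_zero_mulP_X]
  have hw0 : inner ℂ (mono 0) w = discVal a 0 := by
    rw [← inner_mono_toeplitz_mono ha, hyw, inner_add_right, hy0, zero_add]
  -- Since `y(0) = 0`, `w(0) = a(0)`, and outerness gives `|a(0)| = exp ∫ log |a|`. The resulting
  -- bound reverses Cauchy–Schwarz against the constant `1`, so `w` is constant.
  have hle : ‖w‖ ≤ ‖inner ℂ (mono 0) w‖ := by
    rw [hw0, h.norm_discVal_zero]
    exact norm_le_exp_integral_log ha h1 h0 h.2.1 hw1 hw2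
  have hwc : w = (inner ℂ (mono 0) w : ℂ) • mono 0 := by
    set α : ℂ := inner ℂ (mono 0) w with hα
    rw [← sub_eq_zero, ← norm_eq_zero, ← sq_eq_zero_iff]
    have e := norm_sub_sq (𝕜 := ℂ) w (α • mono 0)
    have e2 : inner ℂ w (α • mono 0) = ((‖α‖ ^ 2 : ℝ) : ℂ) := by
      rw [inner_smul_right_H2, ← inner_conj_symm (𝕜 := ℂ) w, ← hα, Complex.mul_conj,
        Complex.normSq_eq_norm_sq]
    have e3 : ‖α • mono 0‖ = ‖α‖ := by
      have := norm_smul α (mono 0)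
      rwa [norm_mono, mul_one] at this
    rw [e2, e3] at e
    have e4 : RCLike.re (((‖α‖ ^ 2 : ℝ) : ℂ)) = ‖α‖ ^ 2 := Complex.ofReal_re _
    rw [e4] at e
    nlinarith [norm_nonneg w, sq_nonneg ‖w - α • mono 0‖]
  apply denseRange_toeplitz_of_mono_mem ha
  have hα : (inner ℂ (mono 0) w : ℂ) ≠ 0 := by
    rw [hw0, ← norm_ne_zero_iff, h.norm_discVal_zero]
    exact (Real.exp_pos _).ne'
  let R : Submodule ℂ H2 := (toeplitz a).range.topologicalClosure
  have hyR : y ∈ R := by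
    refine closure_mono ?_ (hy')
    rintro _ ⟨f, rfl⟩
    exact ⟨mulP X f, rfl⟩
  have haR : toeplitz a (mono 0) ∈ R := Submodule.le_topologicalClosure _ ⟨mono 0, rfl⟩
  have hwR : w ∈ R := by
    have : w = toeplitz a (mono 0) - y := by rw [hyw]; abel
    rw [this]; exact R.sub_mem haR hyR
  rw [hwc] at hwR
  exact (R.smul_mem_iff hα).mp hwR

/-! ### Adjoints of polynomial multiplication and the backward shift. -/

open ContinuousLinearMap (adjoint)

theorem mulP_injective {q : ℂ[X]} (hq : q ≠ 0) : Function.Injective (mulP q) := by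
  intro f g hfg
  apply H2_ext
  filter_upwards [coeFn_mulP q f, coeFn_mulP q g, eval_pt_ne_zero hq] with t h1 h2 h3
  rw [hfg, h2] at h1
  exact (mul_left_cancel₀ h3 h1).symm

/-- The adjoint of multiplication by a polynomial. -/
def adjP (q : ℂ[X]) : H2 →L[ℂ] H2 := adjoint (mulP q)

theorem adjP_inner_left (q : ℂ[X]) (f g : H2) : inner ℂ (adjP q f) g = inner ℂ f (mulP q g) :=
  ContinuousLinearMap.adjoint_inner_left _ _ _

theorem adjP_inner_right (q : ℂ[X]) (f g : H2) : inner ℂ f (adjP q g) = inner ℂ (mulP q f) g :=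
  ContinuousLinearMap.adjoint_inner_right _ _ _

theorem adjP_mul (p q : ℂ[X]) (f : H2) : adjP (p * q) f = adjP p (adjP q f) := by
  unfold adjP
  rw [mul_comm, mulP_mul, ContinuousLinearMap.mul_def, ContinuousLinearMap.adjoint_comp]
  rfl

theorem adjP_comm (p q : ℂ[X]) (f : H2) : adjP p (adjP q f) = adjP q (adjP p f) := by
  rw [← adjP_mul, mul_comm, adjP_mul]

theorem adjP_add (p q : ℂ[X]) (f : H2) : adjP (p + q) f = adjP p f + adjP q f := by
  unfold adjP
  rw [mulP_add, map_add]
  rfl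

theorem adjP_one (f : H2) : adjP 1 f = f := by
  refine ext_inner_right ℂ fun g => ?_
  rw [adjP_inner_left, mulP_one, one_apply_eq_self]

theorem inner_mulP_mulP_X_pow {q r : ℂ[X]} {m : ℕ}
    (h : ∀ t, r.eval (pt t) = pt t ^ m * conj (q.eval (pt t))) (f g : H2) :
    inner ℂ (mulP q f) (mulP (X ^ m) g) = inner ℂ f (mulP r g) := by
  simp only [Submodule.coe_inner, L2.inner_def]
  apply integral_congr_ae
  filter_upwards [coeFn_mulP q f, coeFn_mulP (X ^ m) g, coeFn_mulP r g] with t h1 h2 h3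
  rw [h1, h2, h3, h]
  simp only [RCLike.inner_apply, map_mul, eval_pow, eval_X]
  ring

theorem adjP_X_mulP_X (f : H2) : adjP X (mulP X f) = f := by
  refine ext_inner_right ℂ fun g => ?_
  have := inner_mulP_mulP_X_pow (q := X) (r := 1) (m := 1)
    (fun t => by rw [eval_one, eval_X, pow_one, pt_mul_conj]) f g
  rw [pow_one, mulP_one, one_apply_eq_self] at this
  rw [adjP_inner_left, this]

theorem eq_smul_mono_add (f : H2) :
    f = (inner ℂ (mono 0) f : ℂ) • mono 0 + mulP X (adjP X f) := by
  rw [← sub_eq_zero]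
  apply eq_zero_of_inner_mono
  intro n
  rw [inner_sub_right, inner_add_right, inner_smul_right_H2]
  cases n with
  | zero => rw [inner_mono_self, inner_mono_zero_mulP_X]; ring
  | succ n =>
    rw [inner_mono_mono (Nat.succ_ne_zero n), ← mulP_X_mono, ← adjP_inner_right X _ f,
      ← adjP_inner_right X _ (mulP X (adjP X f)), adjP_X_mulP_X]
    ring

theorem norm_sq_eq_add (f : H2) : ‖f‖ ^ 2 = ‖inner ℂ (mono 0) f‖ ^ 2 + ‖adjP X f‖ ^ 2 := by
  have h1 : ‖mulP X (adjP X f)‖ = ‖adjP X f‖ := by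
    have : inner ℂ (mulP X (adjP X f)) (mulP X (adjP X f))
        = inner ℂ (adjP X f) (adjP X f) := by
      rw [← adjP_inner_right, adjP_X_mulP_X]
    simp only [Submodule.coe_inner, inner_self_eq_norm_sq_to_K] at this
    have h2 : ‖mulP X (adjP X f)‖ ^ 2 = ‖adjP X f‖ ^ 2 := by exact_mod_cast this
    exact (pow_left_inj₀ (norm_nonneg _) (norm_nonneg _) two_ne_zero).mp h2
  have h3 : ‖(inner ℂ (mono 0) f : ℂ) • mono 0‖ = ‖inner ℂ (mono 0) f‖ := by
    have := norm_smul (inner ℂ (mono 0) f : ℂ) (mono 0)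
    rwa [norm_mono, mul_one] at this
  have h4 := norm_add_sq (𝕜 := ℂ) ((inner ℂ (mono 0) f : ℂ) • mono 0) (mulP X (adjP X f))
  rw [inner_smul_left_H2, inner_mono_zero_mulP_X, mul_zero, ← eq_smul_mono_add, h1, h3] at h4
  rw [h4]; simp

/-- As `D(0) = 1`, comparing constant terms in `z^m u = D v` lets one factor `z` at a time be split
off `v`. -/
theorem exists_eq_mulP_X_pow {D : ℂ[X]} (hD : D.coeff 0 = 1) {m : ℕ} {u v : H2}
    (h : mulP (X ^ m) u = mulP D v) : ∃ g, v = mulP (X ^ m) g ∧ u = mulP D g := by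
  induction m generalizing v with
  | zero =>
    rw [pow_zero, mulP_one, one_apply_eq_self] at h
    exact ⟨v, by rw [pow_zero, mulP_one, one_apply_eq_self], h⟩
  | succ m ih =>
    rw [pow_succ', mulP_mul, mul_apply_eq_comp] at h
    have h0 : inner ℂ (mono 0) v = (0 : ℂ) := by
      have := inner_mono_zero_mulP D v
      rw [← h, inner_mono_zero_mulP_X, hD, one_mul] at this
      exact this.symm
    have hv : v = mulP X (adjP X v) := by
      have := eq_smul_mono_add v
      rwa [h0, zero_smul, zero_add] at this
    obtain ⟨g, hg, hu⟩ := ih (v := adjP X v) (by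
      apply mulP_injective X_ne_zero
      rw [h]
      conv_lhs => rw [hv]
      exact congr($(mulP_comm D X) (adjP X v)))
    refine ⟨g, ?_, hu⟩
    rw [pow_succ', mulP_mul, mul_apply_eq_comp, ← hg, ← hv]

/-! ### The operator `T_{φ̄_m}` on `q H(b)`. -/

section Adjoint

variable {m : ℕ} (lam : Fin m → Circle)

theorem den_coeff_zero : (den lam).coeff 0 = 1 := by
  rw [coeff_zero_eq_eval_zero, eval_den]; simp

theorem den_ne_zero : den lam ≠ 0 := fun h => by
  have := den_coeff_zero lam
  simp [h] at this

theorem mem_domain_iff {u v : H2} (k : ℕ) :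
    (v : L2) =ᵐ[haarAddCircle] (fun t => phi lam (X ^ k) t * (u : L2) t) ↔
      ∃ g, v = mulP (X ^ k) g ∧ u = mulP (den lam) g := by
  constructor
  · intro h
    apply exists_eq_mulP_X_pow (den_coeff_zero lam)
    apply H2_ext
    filter_upwards [h, coeFn_mulP (X ^ k) u, coeFn_mulP (den lam) v,
      eval_pt_ne_zero (den_ne_zero lam)] with t h1 h2 h3 h4
    rw [h2, h3, h1, phi, ← eval_den]
    field_simp
  · rintro ⟨g, rfl, rfl⟩
    filter_upwards [coeFn_mulP (X ^ k) g, coeFn_mulP (den lam) g,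
      eval_pt_ne_zero (den_ne_zero lam)] with t h2 h3 h4
    rw [h2, h3, phi, ← eval_den]
    field_simp

theorem dense_range_mulP_den : Dense (Set.range (mulP (den lam))) := by
  have h : (mulP (den lam)).rangeᗮ = ⊥ := by
    rw [ContinuousLinearMap.orthogonal_range]
    exact LinearMap.ker_eq_bot.mpr (injective_adjoint_den lam)
  have := (Submodule.topologicalClosure_eq_top_iff).mpr h
  exact (Submodule.dense_iff_topologicalClosure_eq_top).mpr this

theorem dense_domain_toeplitzU (k : ℕ) :
    Dense ((toeplitzU (phi lam (X ^ k))).domain : Set H2) := by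
  refine (dense_range_mulP_den lam).mono ?_
  rintro _ ⟨g, rfl⟩
  exact ⟨mulP (X ^ k) g, (mem_domain_iff lam k).mpr ⟨g, rfl, rfl⟩⟩

variable {lam}

/-- Writing `x = D g` and `T_{φ_m} x = z^m g`, the identity `z^m q̄ = r` on the circle moves `q`
across the inner product. -/
theorem inner_adjP_eq {q r : ℂ[X]} (h : ∀ t, r.eval (pt t) = pt t ^ m * conj (q.eval (pt t)))
    (k : H2) (x : (toeplitzU (phi lam (X ^ m))).domain) :
    inner ℂ (adjP r k) (x : H2)
      = inner ℂ (polyMul q (adjP (den lam) k)) (toeplitzU (phi lam (X ^ m)) x) := by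
  obtain ⟨g, hg, hx⟩ := (mem_domain_iff lam m).mp (coeFn_toeplitzU (phi lam (X ^ m)) x)
  rw [hg, hx, ← mulP_eq_polyMul, inner_mulP_mulP_X_pow h, ← adjP_inner_left, ← adjP_inner_left,
    adjP_comm]

theorem polyMul_mem_domain {q r : ℂ[X]}
    (h : ∀ t, r.eval (pt t) = pt t ^ m * conj (q.eval (pt t))) (k : H2) :
    polyMul q (adjP (den lam) k) ∈ (toeplitzConj (phi lam (X ^ m))).domain :=
  LinearPMap.mem_adjoint_domain_of_exists _ ⟨adjP r k, inner_adjP_eq h k⟩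

theorem toeplitzConj_polyMul {q r : ℂ[X]}
    (h : ∀ t, r.eval (pt t) = pt t ^ m * conj (q.eval (pt t))) (k : H2)
    (hk : polyMul q (adjP (den lam) k) ∈ (toeplitzConj (phi lam (X ^ m))).domain) :
    toeplitzConj (phi lam (X ^ m)) ⟨polyMul q (adjP (den lam) k), hk⟩ = adjP r k :=
  LinearPMap.adjoint_apply_eq (dense_domain_toeplitzU lam m) _ (inner_adjP_eq h k)

end Adjoint

/-! ### `H(b)` as the range of `T_D*`, with its norm. -/

theorem isCoprime_den {m : ℕ} {lam : Fin m → Circle} {p : ℂ[X]}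
    (hp : ∀ j, p.eval (lam j : ℂ) ≠ 0) : IsCoprime p (den lam) := by
  refine IsCoprime.prod_right fun j _ => ?_
  have hl : conj (lam j : ℂ) * lam j = 1 := by
    rw [mul_comm, Complex.mul_conj, Circle.normSq_coe]; simp
  have h1 : (1 - C (conj (lam j : ℂ)) * X : ℂ[X]) = C (-conj (lam j : ℂ)) * (X - C (lam j : ℂ)) := by
    rw [mul_sub, ← C_mul, neg_mul, hl, C_neg, C_neg, C_1]; ring
  have hu : IsUnit (C (-conj (lam j : ℂ)) : ℂ[X]) := by
    rw [isUnit_C, isUnit_iff_ne_zero, neg_ne_zero]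
    exact left_ne_zero_of_mul_eq_one hl
  rw [h1, isCoprime_mul_unit_left_right hu, isCoprime_comm,
    (irreducible_X_sub_C _).coprime_iff_not_dvd, dvd_iff_isRoot]
  exact hp j

section Pair

variable {m : ℕ} {lam : Fin m → Circle} {p : ℂ[X]} {b a : Linf}

theorem IsPair.ne_zero_ae (hp : p ≠ 0)
    (hφ : ∀ᵐ t ∂(haarAddCircle : Measure T), phi lam p t = b t / a t) :
    ∀ᵐ t ∂(haarAddCircle : Measure T), a t ≠ 0 := by
  filter_upwards [hφ, eval_pt_ne_zero hp, eval_pt_ne_zero (den_ne_zero lam)] with t h1 h2 h3 h0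
  -- With `b / 0 = 0`, a zero of `a` would be a zero of `p / D`, which is excluded almost
  -- everywhere.
  rw [h0, div_zero, phi, ← eval_den] at h1
  exact div_ne_zero h2 h3 h1

theorem IsPair.injective_adjoint (hba : IsPair b a)
    (h0 : ∀ᵐ t ∂(haarAddCircle : Measure T), a t ≠ 0) :
    Function.Injective (adjoint (toeplitz a)) := by
  refine injective_adjoint_of_dense (hba.outer.denseRange ?_ h0)
  filter_upwards [hba.sq_add_sq] with t ht
  nlinarith [norm_nonneg (a t), sq_nonneg ‖b t‖]

theorem adjoint_toeplitz_adjP {b : Linf} (hb : b ∈ Hinf) (q : ℂ[X]) (f : H2) :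
    adjoint (toeplitz b) (adjP q f) = adjP q (adjoint (toeplitz b) f) := by
  have := congrArg adjoint (toeplitz_mulP_comm hb q)
  rw [ContinuousLinearMap.mul_def, ContinuousLinearMap.mul_def,
    ContinuousLinearMap.adjoint_comp, ContinuousLinearMap.adjoint_comp] at this
  exact congr($this f).symm

/-- This is the adjoint form of `b D = a p`. -/
theorem adjP_den_adjoint_toeplitz (hba : IsPair b a)
    (h0 : ∀ᵐ t ∂(haarAddCircle : Measure T), a t ≠ 0)
    (hφ : ∀ᵐ t ∂(haarAddCircle : Measure T), phi lam p t = b t / a t) (f : H2) :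
    adjP (den lam) (adjoint (toeplitz b) f) = adjoint (toeplitz a) (adjP p f) := by
  refine ext_inner_right ℂ fun g => ?_
  rw [adjP_inner_left, ContinuousLinearMap.adjoint_inner_left,
    ContinuousLinearMap.adjoint_inner_left, adjP_inner_left]
  congr 1
  apply H2_ext
  filter_upwards [hφ, h0, eval_pt_ne_zero (den_ne_zero lam), coeFn_mulP (den lam) g,
    coeFn_toeplitz hba.mem (mulP (den lam) g), coeFn_toeplitz hba.outer.1 g,
    coeFn_mulP p (toeplitz a g)] with t h1 h2 h3 h4 h5 h6 h7
  rw [h5, h4, h7, h6]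
  rw [phi, ← eval_den, div_eq_div_iff h3 h2] at h1
  linear_combination (-(g : L2) t) * h1

theorem adjoint_toeplitz_eq_iff (hba : IsPair b a)
    (h0 : ∀ᵐ t ∂(haarAddCircle : Measure T), a t ≠ 0)
    (hφ : ∀ᵐ t ∂(haarAddCircle : Measure T), phi lam p t = b t / a t) (f x : H2) :
    adjoint (toeplitz a) x = adjoint (toeplitz b) f ↔ adjP (den lam) x = adjP p f := by
  have hbp := adjP_den_adjoint_toeplitz hba h0 hφ f
  constructor
  · intro h
    apply hba.injective_adjoint h0
    rw [adjoint_toeplitz_adjP hba.outer.1, h, hbp]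
  · intro h
    apply injective_adjoint_den lam
    change adjP (den lam) _ = adjP (den lam) _
    rw [← adjoint_toeplitz_adjP hba.outer.1, h, hbp]

theorem mem_dBR_iff (hba : IsPair b a) (hp : ∀ j, p.eval (lam j : ℂ) ≠ 0)
    (h0 : ∀ᵐ t ∂(haarAddCircle : Measure T), a t ≠ 0)
    (hφ : ∀ᵐ t ∂(haarAddCircle : Measure T), phi lam p t = b t / a t) (f : H2) :
    f ∈ dBR b ↔ ∃ k, f = adjP (den lam) k := by
  rw [dBR, defect_eq, mem_range_opSqrt_iff hba.adjoint_comp_add]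
  simp only [adjoint_toeplitz_eq_iff hba h0 hφ]
  constructor
  · rintro ⟨x, hx⟩
    obtain ⟨u, v, huv⟩ := isCoprime_den hp
    -- Applying the Bézout identity `u p + v D = 1` to `f` and replacing `T_p* f` by `T_D* x`
    -- exhibits `f` in the range of `T_D*`.
    refine ⟨adjP u x + adjP v f, ?_⟩
    have := adjP_add (u * p) (v * den lam) f
    rw [huv, adjP_one, adjP_mul, adjP_mul, ← hx] at this
    rw [map_add, adjP_comm (den lam) u, adjP_comm (den lam) v]
    exact this
  · rintro ⟨k, rfl⟩
    exact ⟨adjP p k, adjP_comm _ _ _⟩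

theorem normB_adjP_den (hba : IsPair b a)
    (h0 : ∀ᵐ t ∂(haarAddCircle : Measure T), a t ≠ 0)
    (hφ : ∀ᵐ t ∂(haarAddCircle : Measure T), phi lam p t = b t / a t) (k : H2) :
    normB b (adjP (den lam) k) ^ 2 = ‖adjP (den lam) k‖ ^ 2 + ‖adjP p k‖ ^ 2 := by
  rw [normB, defect_eq]
  exact sInf_norm_preimage_opSqrt hba.adjoint_comp_add (hba.injective_adjoint h0)
    ((adjoint_toeplitz_eq_iff hba h0 hφ _ _).mpr (adjP_comm _ _ _))

end Pair

/-! ### Reciprocal polynomials and rigidity of the norm identity. -/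

/-- The reciprocal polynomial `z ^ m * conj (q (1 / conj z))`. -/
def recip (m : ℕ) (q : ℂ[X]) : ℂ[X] := (q.map (starRingEnd ℂ)).reflect m

theorem eval_recip {m : ℕ} {q : ℂ[X]} (hq : q.natDegree ≤ m) {z : ℂ} (hz : z ≠ 0) :
    (recip m q).eval z = z ^ m * conj (q.eval (1 / conj z)) := by
  let _ : Invertible z⁻¹ := invertibleOfNonzero (inv_ne_zero hz)
  have h := eval₂_reflect_mul_pow (RingHom.id ℂ) z⁻¹ m (q.map (starRingEnd ℂ))
    (natDegree_map_le.trans hq)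
  rw [invOf_eq_inv, inv_inv] at h
  change (recip m q).eval z * z⁻¹ ^ m = (q.map (starRingEnd ℂ)).eval z⁻¹ at h
  have h2 : (q.map (starRingEnd ℂ)).eval z⁻¹ = conj (q.eval (1 / conj z)) := by
    have := Polynomial.eval_map_apply (p := q) (f := starRingEnd ℂ) (1 / conj z)
    rw [← this]; simp
  rw [← h2, ← h, inv_pow]
  field_simp

theorem eval_recip_pt {m : ℕ} {q : ℂ[X]} (hq : q.natDegree ≤ m) (t : T) :
    (recip m q).eval (pt t) = pt t ^ m * conj (q.eval (pt t)) := by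
  have h0 : pt t ≠ 0 := norm_ne_zero_iff.mp (by rw [pt_norm]; exact one_ne_zero)
  rw [eval_recip hq h0]
  have h1 : 1 / conj (pt t) = pt t := by
    have h2 : conj (pt t) ≠ 0 := by simpa using h0
    rw [div_eq_iff h2, pt_mul_conj]
  rw [h1]

theorem pow_mul_conj_eval_recip {m : ℕ} {q : ℂ[X]} (hq : q.natDegree ≤ m) {z : ℂ} (hz : z ≠ 0) :
    z ^ m * conj ((recip m q).eval (1 / conj z)) = q.eval z := by
  have hz' : (1 / conj z) ≠ 0 := by simpa using hz
  rw [eval_recip hq hz']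
  simp [hz]

/-- The test vector `v - α u`, with `α u` the projection of `v` on the line of `u`, is orthogonal to
`u`, hence to `v`, hence zero. -/
theorem exists_smul_eq_of_norm_inner_eq {H : Type*} [NormedAddCommGroup H] [InnerProductSpace ℂ H]
    {u v : H} (hu : u ≠ 0) (h : ∀ k, ‖inner ℂ u k‖ = ‖inner ℂ v k‖) :
    ∃ α : ℂ, ‖α‖ = 1 ∧ v = α • u := by
  have huu : inner ℂ u u ≠ 0 := inner_self_ne_zero.mpr hu
  set α : ℂ := inner ℂ u v / inner ℂ u u with hα
  have h1 : inner ℂ u (v - α • u) = 0 := by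
    rw [inner_sub_right, inner_smul_right, hα, div_mul_cancel₀ _ huu, sub_self]
  have h2 : inner ℂ v (v - α • u) = 0 := by
    rw [← norm_eq_zero, ← h, h1, norm_zero]
  have h3 : v - α • u = 0 := by
    rw [← inner_self_eq_zero (𝕜 := ℂ), inner_sub_left, h2, inner_smul_left, h1, mul_zero, sub_zero]
  have hv : v = α • u := sub_eq_zero.mp h3
  refine ⟨α, ?_, hv⟩
  have h4 := h u
  rw [hv, inner_smul_left, norm_mul, RCLike.norm_conj] at h4
  have h5 : ‖inner ℂ u u‖ ≠ 0 := norm_ne_zero_iff.mpr huu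
  exact (mul_right_cancel₀ h5 ((one_mul _).trans h4)).symm

/-- `T_p*` commutes with `S*`, so in `‖g‖² = |g(0)|² + ‖S* g‖²` with `g = T_p* k` the last term is
the hypothesis at `S* k`; what remains is `|⟨p, k⟩|²`. -/
theorem norm_inner_eq_of_norm_adjP_eq {p r : ℂ[X]} (h : ∀ k, ‖adjP p k‖ = ‖adjP r k‖) (k : H2) :
    ‖inner ℂ (mulP p (mono 0)) k‖ = ‖inner ℂ (mulP r (mono 0)) k‖ := by
  have h1 := norm_sq_eq_add (adjP p k)
  have h2 := norm_sq_eq_add (adjP r k)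
  rw [adjP_comm, adjP_inner_right] at h1 h2
  rw [h k, h (adjP X k), h2] at h1
  exact (pow_left_inj₀ (norm_nonneg _) (norm_nonneg _) two_ne_zero).mp (by linarith)

theorem eq_C_mul_of_mulP_eq {p r : ℂ[X]} {α : ℂ}
    (h : mulP r (mono 0) = α • mulP p (mono 0)) : r = C α * p := by
  rw [← sub_eq_zero]
  by_contra hne
  have h1 : mulP (r - C α * p) (mono 0) = 0 := by
    rw [sub_eq_add_neg, ← neg_mul, ← C_neg, mulP_add, mulP_mul, mulP_C, add_apply,
      mul_apply_eq_comp, smul_apply, one_apply_eq_self, h, neg_smul, add_neg_cancel]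
  have h2 : mono 0 = 0 := mulP_injective hne (by rw [h1, map_zero])
  have h3 := norm_mono 0
  rw [h2, norm_zero] at h3
  exact zero_ne_one h3

theorem norm_adjP_C_mul {α : ℂ} (hα : ‖α‖ = 1) (p : ℂ[X]) (k : H2) :
    ‖adjP (C α * p) k‖ = ‖adjP p k‖ := by
  have : adjP (C α) (adjP p k) = conj α • adjP p k := by
    refine ext_inner_right ℂ fun g => ?_
    rw [adjP_inner_left, mulP_C, inner_smul_left_H2, Complex.conj_conj, smul_apply,
      one_apply_eq_self, inner_smul_right_H2]
  rw [adjP_mul, this]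
  refine (norm_smul _ _).trans ?_
  rw [RCLike.norm_conj, hα, one_mul]

end DBR

end

/-! ### The main theorem. -/

theorem mainTheorem4 (m : ℕ) (hm : 0 < m) (lam : Fin m → Circle)
    (p q : Polynomial ℂ) (hp : p.natDegree ≤ m) (hq : q.natDegree ≤ m)
    (hp0 : ∀ j, p.eval (lam j : ℂ) ≠ 0) (hq0 : ∀ j, q.eval (lam j : ℂ) ≠ 0)
    (b a : DBR.Linf) (hba : DBR.IsPair b a)
    (hφ : ∀ᵐ t ∂(AddCircle.haarAddCircle : MeasureTheory.Measure DBR.T),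
      DBR.phi lam p t = b t / a t) :
    (∀ f ∈ DBR.dBR b,
      DBR.polyMul q f ∈ (DBR.toeplitzConj (DBR.phi lam (Polynomial.X ^ m))).domain) ∧
    ((∀ f ∈ DBR.dBR b,
        ∃ h : DBR.polyMul q f ∈ (DBR.toeplitzConj (DBR.phi lam (Polynomial.X ^ m))).domain,
          DBR.normB b f ^ 2 = ‖f‖ ^ 2 +
            ‖DBR.toeplitzConj (DBR.phi lam (Polynomial.X ^ m)) ⟨DBR.polyMul q f, h⟩‖ ^ 2) ↔
      ∃ c : ℂ, ‖c‖ = 1 ∧ ∀ z : ℂ, z ≠ 0 →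
        q.eval z = c * (z ^ m * starRingEnd ℂ (p.eval (1 / starRingEnd ℂ z)))) := by
  open DBR in
  have hpne : p ≠ 0 := fun h => hp0 ⟨0, hm⟩ (by rw [h, eval_zero])
  have h0 := IsPair.ne_zero_ae hpne hφ
  have hmem := mem_dBR_iff hba hp0 h0 hφ
  have hr := eval_recip_pt hq
  have hiff : (∀ f ∈ dBR b, ∃ h : polyMul q f ∈ (toeplitzConj (phi lam (X ^ m))).domain,
      normB b f ^ 2 = ‖f‖ ^ 2 + ‖toeplitzConj (phi lam (X ^ m)) ⟨polyMul q f, h⟩‖ ^ 2) ↔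
      ∀ k, ‖adjP p k‖ = ‖adjP (recip m q) k‖ := by
    constructor
    · intro H k
      obtain ⟨h, e⟩ := H _ ((hmem _).mpr ⟨k, rfl⟩)
      rw [normB_adjP_den hba h0 hφ, toeplitzConj_polyMul hr] at e
      exact (pow_left_inj₀ (norm_nonneg _) (norm_nonneg _) two_ne_zero).mp (by linarith)
    · intro H f hf
      obtain ⟨k, rfl⟩ := (hmem f).mp hf
      refine ⟨polyMul_mem_domain hr k, ?_⟩
      rw [normB_adjP_den hba h0 hφ, toeplitzConj_polyMul hr, H]
  refine ⟨?_, hiff.trans ⟨?_, ?_⟩⟩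
  · intro f hf
    obtain ⟨k, rfl⟩ := (hmem f).mp hf
    exact polyMul_mem_domain hr k
  · intro H
    have hp1 : mulP p (mono 0) ≠ 0 := fun h => by
      have h1 : mono 0 = 0 := mulP_injective hpne (by rw [h, map_zero])
      have h2 := norm_mono 0
      rw [h1, norm_zero] at h2
      exact zero_ne_one h2
    obtain ⟨α, hα, e⟩ := exists_smul_eq_of_norm_inner_eq hp1 (norm_inner_eq_of_norm_adjP_eq H)
    have hrec := eq_C_mul_of_mulP_eq e
    -- Taking reciprocals is a conjugate-linear involution, so `α` returns as its conjugate.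
    refine ⟨starRingEnd ℂ α, by rw [RCLike.norm_conj, hα], fun z hz => ?_⟩
    rw [← pow_mul_conj_eval_recip hq hz, hrec, eval_mul, eval_C, map_mul]
    ring
  · rintro ⟨c, hc, H⟩ k
    have hrec : recip m q = C (starRingEnd ℂ c) * p := by
      refine eq_C_mul_of_mulP_eq (H2_ext ?_)
      filter_upwards [coeFn_mulP (recip m q) (mono 0), coeFn_mulP p (mono 0),
        Lp.coeFn_smul (starRingEnd ℂ c) (mulP p (mono 0) : L2)] with t h1 h2 h3
      have hz : pt t ≠ 0 := norm_ne_zero_iff.mp (by rw [pt_norm]; exact one_ne_zero)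
      rw [h1, Submodule.coe_smul, h3, Pi.smul_apply, h2, eval_recip_pt hq, H _ hz,
        ← eval_recip hp hz, eval_recip_pt hp]
      simp only [map_mul, map_pow, Complex.conj_conj, smul_eq_mul]
      have : pt t ^ m * starRingEnd ℂ (pt t) ^ m = 1 := by rw [← mul_pow, pt_mul_conj, one_pow]
      linear_combination (starRingEnd ℂ c * p.eval (pt t) * ((mono 0 : H2) : L2) t) * this
    rw [hrec, norm_adjP_C_mul (by rw [RCLike.norm_conj, hc])]
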